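/- Let $D\ge 3$, let $r$ be a prime power and put $q=-r$. Let $\Gamma$ be the dual polar graph ${}^2A_{2D-1}(-q)$: its vertices are the maximal totally isotropic subspaces, equivalently the totally isotropic subspaces of dimension $D$, of a $2D$-dimensional vector space over $\mathbb F_{r^2}$ carrying a nondegenerate Hermitian form (with respect to $a\mapsto a^{r}$), and two of them are adjacent when their intersection has dimension $D-1$. Let $X$ be its vertex set, $\partial$ its path-length distance, $A$ its adjacency matrix, $V=\mathbb C^X$, and fix $x\in X$; the eccentricity of $x$ is $D$. For $0\le i\le D$ let $E_i^*$ be the diagonal matrix with $(y,y)$-entry $1$ if $\partial(x,y)=i$ and $0$ otherwise, and let $L=\sum_{i=1}^{D}E^*_{i-1}AE^*_i$ and $R=\sum_{i=0}^{D-1}E^*_{i+1}AE^*_i$. Definitions. For a connected bipartite graph $G$ and a vertex $x$ of eccentricity $\varepsilon$, a parameter matrix is a tridiagonal complex matrix $U=(e_{ij})_{1\le i,j\le\varepsilon}$ such that (i) $e_{ii}=1$ for all $i$; (ii) $e_{i,i-1}\ne0$ for all $2\le i\le\varepsilon$, or $e_{i-1,i}\neq 0$ for all $2\le i\le\varepsilon$;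 (iii) for all $1\le s\le t\le\varepsilon$ the principal submatrix $(e_{ij})_{s\le i,j\le t}$ is nonsingular. Write $e_i^-=e_{i,i-1}$, $e_i^+=e_{i,i+1}$, $e_1^-=e_\varepsilon^+=0$. A uniform structure of $G$ with respect to $x$ is a pair $(U,f)$ with $U$ a parameter matrix and $f=(f_i)_{i=1}^{\varepsilon}\in\mathbb C^\varepsilon$ such that $e_i^-RL^2+LRL+e_i^+L^2R=f_iL$ holds on $E_i^*V$ for $1\le i\le\varepsilon$, where $L,R,E_i^*$ are formed for $G$ and $x$; it is strongly uniform if moreover $e_i^-\ne0$ for $2\le i\le\varepsilon$ and $e_i^+\ne0$ for $1\le i\le\varepsilon-1$. A connected non-bipartite graph $\Gamma$ supports a (strongly) uniform structure with respect to $x$ if the graph $\Gamma_f$, obtained from $\Gamma$ by deleting all edges $yz$ with $\partial(x,y)=\partial(x,z)$, has one with respect to $x$. Theorem. On $E_i^*V$, for every $1\le i\le D$, $$-\frac{q^4}{q^2+1}RL^2+LRL-\frac{q^{-2}}{q^2+1}L^2R=(-q)^{2D-1}L .$$ Moreover, the tridiagonal $D\times D$ matrix $U$ with $e_{ii}=1$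 $(1\le i\le D)$, $e_{i}^-=-q^4/(q^2+1)$ $(2\le i\le D)$ and $e_{i}^+=-q^{-2}/(q^2+1)$ $(1\le i\le D-1)$ is a parameter matrix (in particular all the principal submatrices $(e_{ij})_{s\le i,j\le t}$, $1\le s\le t\le D$, are nonsingular), and, with $f_i=(-q)^{2D-1}$ for $1\le i\le D$, the graph $\Gamma$ is connected and non-bipartite and supports the strongly uniform structure $(U,f)$ with respect to $x$. -/

import Mathlib

open Matrix

noncomputable section

namespace SimpleGraph

section Terwilliger

variable {X : Type*} [Fintype X]

open scoped Classical in
/-- The `i`-th dual idempotent `E*_i = E*_i(x)`: the diagonal matrix whose `(y,y)`-entry is `1` if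
`∂(x,y) = i` and `0` otherwise. -/
def dualIdempotent (G : SimpleGraph X) (x : X) (i : ℕ) : Matrix X X ℂ :=
  Matrix.diagonal fun y => if G.dist x y = i then 1 else 0

/-- The `i`-th subconstituent `E*_i V` of the standard module `V = ℂ^X`. -/
def subconstituent (G : SimpleGraph X) (x : X) (i : ℕ) : Submodule ℂ (X → ℂ) :=
  LinearMap.range (G.dualIdempotent x i).mulVecLin

open scoped Classical in
/-- The lowering matrix `L = ∑_{i=1}^ε E*_{i-1} A E*_i` with respect to `x`, where `ε` is the
eccentricity of `x` and `A` is the adjacency matrix. -/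
def loweringMatrix (G : SimpleGraph X) (x : X) : Matrix X X ℂ :=
  ∑ i ∈ Finset.Icc 1 (G.eccent x).toNat,
    G.dualIdempotent x (i - 1) * G.adjMatrix ℂ * G.dualIdempotent x i

open scoped Classical in
/-- The raising matrix `R = ∑_{i=0}^{ε-1} E*_{i+1} A E*_i` with respect to `x`. -/
def raisingMatrix (G : SimpleGraph X) (x : X) : Matrix X X ℂ :=
  ∑ i ∈ Finset.range (G.eccent x).toNat,
    G.dualIdempotent x (i + 1) * G.adjMatrix ℂ * G.dualIdempotent x i

/-- The equation `em R L² + L R L + ep L² R = f L` is satisfied on `E*_i V`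
(with respect to the vertex `x` of `G`). -/
def UniformEquationOn (G : SimpleGraph X) (x : X) (i : ℕ) (em ep f : ℂ) : Prop :=
  ∀ v ∈ G.subconstituent x i,
    (em • (G.raisingMatrix x * (G.loweringMatrix x * G.loweringMatrix x))
        + G.loweringMatrix x * G.raisingMatrix x * G.loweringMatrix x
        + ep • (G.loweringMatrix x * G.loweringMatrix x * G.raisingMatrix x)) *ᵥ v
      = (f • G.loweringMatrix x) *ᵥ v

end Terwilliger

/-- The `(i,j)`-entry of an `n × n` matrix with rows and columns numbered `1, …, n`, extended by
`0` when an index is out of range. -/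
def entryFromOne {n : ℕ} (U : Matrix (Fin n) (Fin n) ℂ) (i j : ℕ) : ℂ :=
  if h : (1 ≤ i ∧ i ≤ n) ∧ (1 ≤ j ∧ j ≤ n) then
    U ⟨i - 1, by omega⟩ ⟨j - 1, by omega⟩ else 0

/-- `e⁻_i = e_{i,i-1}` for `2 ≤ i ≤ n`; by the convention of `entryFromOne`, `e⁻_1 = 0`. -/
def eMinus {n : ℕ} (U : Matrix (Fin n) (Fin n) ℂ) (i : ℕ) : ℂ := entryFromOne U i (i - 1)

/-- `e⁺_i = e_{i,i+1}` for `1 ≤ i ≤ n - 1`; by the convention of `entryFromOne`, `e⁺_n = 0`. -/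
def ePlus {n : ℕ} (U : Matrix (Fin n) (Fin n) ℂ) (i : ℕ) : ℂ := entryFromOne U i (i + 1)

/-- Parameter matrices. The row and column number `i ∈ {1, …, n}` corresponds to
`i - 1 : Fin n`. -/
structure IsParameterMatrix {n : ℕ} (U : Matrix (Fin n) (Fin n) ℂ) : Prop where
  /-- `U` is tridiagonal. -/
  tridiagonal : ∀ i j : Fin n, (i : ℕ) + 1 < j ∨ (j : ℕ) + 1 < i → U i j = 0
  /-- The diagonal entries are `1`. -/
  diag : ∀ i : Fin n, U i i = 1
  /-- All subdiagonal entries are nonzero, or all superdiagonal entries are nonzero. -/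
  offDiag : (∀ i, 2 ≤ i → i ≤ n → entryFromOne U i (i - 1) ≠ 0) ∨
    (∀ i, 2 ≤ i → i ≤ n → entryFromOne U (i - 1) i ≠ 0)
  /-- The principal submatrix on rows and columns `s, …, t` is nonsingular whenever `s ≤ t`. -/
  nonsingular : ∀ s t : Fin n, s ≤ t →
    (U.submatrix (Subtype.val : Set.Icc s t → Fin n)
      (Subtype.val : Set.Icc s t → Fin n)).det ≠ 0

variable {X : Type*} [Fintype X]

/-- `(U, f)` is a uniform structure, with respect to the vertex `x`, of the (connected) bipartite
graph `G`. Here `n` is the eccentricity of `x`, and `f i` stands for the `i`-th entry of the vector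
`f` (`1 ≤ i ≤ n`). -/
structure IsUniformStructure (G : SimpleGraph X) (x : X) {n : ℕ}
    (U : Matrix (Fin n) (Fin n) ℂ) (f : Fin n → ℂ) : Prop where
  connected : G.Connected
  bipartite : G.IsBipartite
  eccent_eq : G.eccent x = n
  isParameterMatrix : IsParameterMatrix U
  equation : ∀ i : Fin n,
    G.UniformEquationOn x (i + 1) (eMinus U (i + 1)) (ePlus U (i + 1)) (f i)

/-- A strongly uniform structure: a uniform structure in which all the `e⁻_i` (`2 ≤ i ≤ n`) and all
the `e⁺_i` (`1 ≤ i ≤ n - 1`) are nonzero. -/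
structure IsStronglyUniformStructure (G : SimpleGraph X) (x : X) {n : ℕ}
    (U : Matrix (Fin n) (Fin n) ℂ) (f : Fin n → ℂ) : Prop
    extends IsUniformStructure G x U f where
  eMinus_ne_zero : ∀ i, 2 ≤ i → i ≤ n → eMinus U i ≠ 0
  ePlus_ne_zero : ∀ i, 1 ≤ i → i + 1 ≤ n → ePlus U i ≠ 0

/-- The graph `Γ_f = Γ_f(x)`: delete from `Γ` all the edges `yz` with `∂(x,y) = ∂(x,z)`. -/
def flatDeleted {X : Type*} (G : SimpleGraph X) (x : X) : SimpleGraph X where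
  Adj y z := G.Adj y z ∧ G.dist x y ≠ G.dist x z
  symm := ⟨fun _ _ h => ⟨h.1.symm, h.2.symm⟩⟩
  loopless := ⟨fun _ h => h.2 rfl⟩

/-- The connected non-bipartite graph `G` supports the strongly uniform structure `(U, f)` with
respect to `x`: `(U, f)` is a strongly uniform structure of `G_f(x)`. -/
structure SupportsStronglyUniformWith (G : SimpleGraph X) (x : X) {n : ℕ}
    (U : Matrix (Fin n) (Fin n) ℂ) (f : Fin n → ℂ) : Prop where
  connected : G.Connected
  not_bipartite : ¬ G.IsBipartite
  isStronglyUniform : (G.flatDeleted x).IsStronglyUniformStructure x U f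

end SimpleGraph

section DualPolar

variable {K V : Type*} [Field K] [AddCommGroup V] [Module K V] {σ : K →+* K}

/-- The subspaces of dimension `D` that are totally isotropic for the sesquilinear form `h`. For a
nondegenerate Hermitian form on a space of dimension `2 * D` over a finite field these are exactly
the maximal totally isotropic subspaces. -/
@[ext]
structure IsotropicSubspace (h : V →ₛₗ[σ] V →ₗ[K] K) (D : ℕ) where
  carrier : Submodule K V
  isotropic : ∀ u ∈ carrier, ∀ v ∈ carrier, h u v = 0
  finrank_eq : Module.finrank K carrier = D

instance [Finite K] [FiniteDimensional K V] (h : V →ₛₗ[σ] V →ₗ[K] K) (D : ℕ) :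
    Finite (IsotropicSubspace h D) :=
  haveI : Finite V := Module.finite_of_finite K
  Finite.of_injective (fun W : IsotropicSubspace h D => (W.carrier : Set V))
    fun _ _ hW => IsotropicSubspace.ext (SetLike.coe_injective hW)

instance [Finite K] [FiniteDimensional K V] (h : V →ₛₗ[σ] V →ₗ[K] K) (D : ℕ) :
    Fintype (IsotropicSubspace h D) :=
  Fintype.ofFinite _

/-- The dual polar graph of the form `h`: the vertices are the `D`-dimensional totally isotropic
subspaces, and two of them are adjacent when they meet in a subspace of dimension `D - 1`. For a
nondegenerate Hermitian form `h` on a `2D`-dimensional space over the field with `r ^ 2` elements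
this is the dual polar graph `²A_{2D-1}(r)`. -/
def dualPolarGraph (h : V →ₛₗ[σ] V →ₗ[K] K) (D : ℕ) : SimpleGraph (IsotropicSubspace h D) where
  Adj W W' := Module.finrank K (W.carrier ⊓ W'.carrier : Submodule K V) + 1 = D
  symm := ⟨fun W W' hW => inf_comm W.carrier W'.carrier ▸ hW⟩
  loopless := ⟨fun W hW => by
    rw [inf_idem, W.finrank_eq] at hW
    omega⟩

end DualPolar

/-- The `D × D` tridiagonal matrix with `e_{i,i} = 1`, `e_{i,i-1} = -q⁴/(q²+1)` and
`e_{i,i+1} = -q⁻²/(q²+1)`. -/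
def dualPolarParameterMatrix (q : ℤ) (D : ℕ) : Matrix (Fin D) (Fin D) ℂ :=
  Matrix.of fun i j =>
    if i = j then 1
    else if (i : ℕ) = j + 1 then -((q : ℂ) ^ 4 / ((q : ℂ) ^ 2 + 1))
    else if (j : ℕ) = i + 1 then -((q : ℂ) ^ (-2 : ℤ) / ((q : ℂ) ^ 2 + 1))
    else 0

end

/-!
The distance from `x` to `y` is the codimension of `x ∩ y`, and the lower neighbours of `y` are the
projections of `y` on the hyperplane extensions `U` of `x ∩ y` inside `x`. Put `s = r ^ 2`. If two
vertices `z`, `w` have different intersections with `x`, they have at most one common lower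
neighbour, and `s` times as many common upper neighbours; if the intersections agree and `z ≠ w`,
they have no common upper neighbour. With `R = Lᵀ`, the diagonal matrix `Δ` of the numbers of upper
neighbours, and `P` the part of `R L` that preserves the intersection with `x`, this says
`L R = Δ + s (R L - P)`. A further count gives `L P = N L + s ^ 2 P L` with a diagonal matrix `N`,
and eliminating `P` from `L R L` and `L ^ 2 R` leaves the cubic relation.
-/

section Subspaces

open Module

theorem finite_submodule (K V : Type*) [Field K] [AddCommGroup V] [Module K V] [Finite K]
    [FiniteDimensional K V] : Finite (Submodule K V) :=
  haveI : Finite V := Module.finite_of_finite K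
  Finite.of_injective (fun W : Submodule K V => (W : Set V)) SetLike.coe_injective

variable {K V : Type*} [Field K] [AddCommGroup V] [Module K V] [FiniteDimensional K V]

theorem finrank_add_finrank_le_of_le {A B W : Submodule K V} (hA : A ≤ W) (hB : B ≤ W) :
    finrank K A + finrank K B ≤ finrank K W + finrank K (A ⊓ B : Submodule K V) := by
  have := Submodule.finrank_sup_add_finrank_inf_eq A B
  have := Submodule.finrank_mono (sup_le hA hB)
  omega

theorem sup_eq_of_finrank_add_one {A B U : Submodule K V} (hAB : A ≤ B) (hUB : U ≤ B)
    (hB : finrank K A + 1 = finrank K B) (hU : ¬ U ≤ A) : A ⊔ U = B := by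
  refine Submodule.eq_of_le_of_finrank_le (sup_le hAB hUB) ?_
  have := Submodule.finrank_lt_finrank_of_lt (left_lt_sup.2 hU)
  omega

omit [FiniteDimensional K V] in
theorem ncard_lines_le [Finite K] (W : Submodule K V) :
    {P : Submodule K V | P ≤ W ∧ finrank K P = 1}.ncard =
      ∑ k ∈ Finset.range (finrank K W), Nat.card K ^ k := by
  have himage : {P : Submodule K V | P ≤ W ∧ finrank K P = 1} =
      Submodule.map W.subtype '' {P | finrank K P = 1} := by
    ext P
    constructor
    · rintro ⟨hPW, hP⟩
      refine ⟨P.comap W.subtype, ?_, Submodule.map_comap_eq_self (by simpa using hPW)⟩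
      rwa [Set.mem_ofPred_eq, (Submodule.comapSubtypeEquivOfLe hPW).finrank_eq]
    · rintro ⟨P, hP, rfl⟩
      exact ⟨Submodule.map_subtype_le W P, (Submodule.finrank_map_subtype_eq W P).trans hP⟩
  rw [himage, Set.ncard_image_of_injective _ (Submodule.map_injective_of_injective
      W.injective_subtype), ← Projectivization.card_of_finrank K W rfl]
  exact (Nat.card_congr (Projectivization.equivSubmodule K W)).symm

theorem ncard_hyperplanes_ge [Finite K] (A : Submodule K V) :
    {C : Submodule K V | A ≤ C ∧ finrank K C + 1 = finrank K V}.ncard =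
      ∑ k ∈ Finset.range (finrank K V - finrank K A), Nat.card K ^ k := by
  have hpreimage : {C : Submodule K V | A ≤ C ∧ finrank K C + 1 = finrank K V} =
      Submodule.dualAnnihilator ⁻¹' {P | P ≤ A.dualAnnihilator ∧ finrank K P = 1} := by
    ext C
    refine and_congr Subspace.dualAnnihilator_le_dualAnnihilator_iff.symm ?_
    have := Subspace.finrank_add_finrank_dualAnnihilator_eq C
    omega
  have hbij : Function.Bijective (Submodule.dualAnnihilator (R := K) (M := V)) :=
    OrderDual.ofDual.bijective.comp (Subspace.orderIsoFiniteDimensional (K := K) (V := V)).bijective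
  rw [hpreimage, Set.ncard_preimage_of_injective_subset_range hbij.1
      (hbij.2.range_eq ▸ Set.subset_univ _), ncard_lines_le,
    Nat.eq_sub_of_add_eq' (Subspace.finrank_add_finrank_dualAnnihilator_eq A)]

open scoped Classical in
/-- The hyperplanes of `B` that contain `A`. -/
noncomputable def hyperplanesBetween [Finite K] (A B : Submodule K V) : Finset (Submodule K V) :=
  haveI := finite_submodule K V
  haveI := Fintype.ofFinite (Submodule K V)
  {C | A ≤ C ∧ C ≤ B ∧ finrank K C + 1 = finrank K B}

theorem mem_hyperplanesBetween [Finite K] {A B C : Submodule K V} :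
    C ∈ hyperplanesBetween A B ↔ A ≤ C ∧ C ≤ B ∧ finrank K C + 1 = finrank K B := by
  simp [hyperplanesBetween]

theorem card_hyperplanesBetween [Finite K] {A B : Submodule K V} (hAB : A ≤ B) :
    (hyperplanesBetween A B).card =
      ∑ k ∈ Finset.range (finrank K B - finrank K A), Nat.card K ^ k := by
  have himage : (hyperplanesBetween A B : Set (Submodule K V)) =
      Submodule.map B.subtype ''
        {C | A.comap B.subtype ≤ C ∧ finrank K C + 1 = finrank K B} := by
    ext C
    rw [Finset.mem_coe, mem_hyperplanesBetween]
    constructor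
    · rintro ⟨hAC, hCB, hC⟩
      refine ⟨C.comap B.subtype, ⟨Submodule.comap_mono hAC, ?_⟩,
        Submodule.map_comap_eq_self (by simpa using hCB)⟩
      rwa [(Submodule.comapSubtypeEquivOfLe hCB).finrank_eq]
    · rintro ⟨C, ⟨hAC, hC⟩, rfl⟩
      refine ⟨?_, Submodule.map_subtype_le B C, (Submodule.finrank_map_subtype_eq B C).symm ▸ hC⟩
      exact (Submodule.map_comap_eq_self (f := B.subtype) (q := A) (by simpa using hAB)).ge.trans
        (Submodule.map_mono hAC)
  rw [← Set.ncard_coe_finset, himage, Set.ncard_image_of_injective _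
      (Submodule.map_injective_of_injective B.injective_subtype), ncard_hyperplanes_ge,
    (Submodule.comapSubtypeEquivOfLe hAB).finrank_eq]

theorem card_hyperplanesBetween_sdiff [Finite K] {A U B : Submodule K V} (hAU : A ≤ U)
    (hUB : U ≤ B) :
    (hyperplanesBetween A B \ hyperplanesBetween U B).card =
      (∑ k ∈ Finset.range (finrank K U - finrank K A), Nat.card K ^ k) *
        Nat.card K ^ (finrank K B - finrank K U) := by
  have hsub : hyperplanesBetween U B ⊆ hyperplanesBetween A B := fun C hC => by
    rw [mem_hyperplanesBetween] at hC ⊢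
    exact ⟨hAU.trans hC.1, hC.2⟩
  have hA := Submodule.finrank_mono hAU
  have hU := Submodule.finrank_mono hUB
  rw [Finset.card_sdiff_of_subset hsub, card_hyperplanesBetween (hAU.trans hUB),
    card_hyperplanesBetween hUB,
    show finrank K B - finrank K A =
      (finrank K B - finrank K U) + (finrank K U - finrank K A) by omega,
    Finset.sum_range_add, Nat.add_sub_cancel_left, Finset.sum_mul]
  exact Finset.sum_congr rfl fun k _ => by rw [pow_add, mul_comm]

end Subspaces

section Trace

open Polynomial

theorem card_pow_eq_linear_le {F : Type*} [Field F] [Fintype F] [DecidableEq F] {r : ℕ}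
    (hr : 1 < r) (a b : F) : (Finset.univ.filter fun t : F => t ^ r = a * t + b).card ≤ r := by
  have hdeg : (C a * X + C b : F[X]).natDegree < (X ^ r : F[X]).natDegree := by
    rw [natDegree_X_pow]
    exact natDegree_linear_le.trans_lt hr
  have hne : (X ^ r - (C a * X + C b) : F[X]) ≠ 0 := fun h0 => hdeg.ne' (by rw [sub_eq_zero.1 h0])
  calc (Finset.univ.filter fun t : F => t ^ r = a * t + b).card
      ≤ (X ^ r - (C a * X + C b) : F[X]).roots.toFinset.card :=
        Finset.card_le_card fun t ht => by simpa [hne, sub_eq_zero] using ht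
    _ ≤ (X ^ r - (C a * X + C b) : F[X]).natDegree :=
        (Multiset.toFinset_card_le _).trans (card_roots' _)
    _ = r := by rw [natDegree_sub_eq_left_of_natDegree_lt hdeg, natDegree_X_pow]

/-- Each of the at most `r` fixed elements of `σ` has at most `r` preimages under `t ↦ t + σ t`,
and these preimages exhaust the `r ^ 2` elements of `F`. -/
theorem card_add_conj_eq {F : Type*} [Field F] [Fintype F] [DecidableEq F] {r : ℕ}
    (hF : Fintype.card F = r ^ 2) (hr : 1 < r) {σ : F →+* F} (hσ : ∀ a, σ a = a ^ r) {c : F}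
    (hc : σ c = c) : (Finset.univ.filter fun t : F => t + σ t = c).card = r := by
  have hinv : ∀ a, σ (σ a) = a := fun a => by
    rw [hσ, hσ, ← pow_mul, ← sq, ← hF, FiniteField.pow_card]
  set fixed : Finset F := Finset.univ.filter fun a => σ a = a with hfixed
  have hfiber : ∀ d, (Finset.univ.filter fun t : F => t + σ t = d).card ≤ r := fun d => by
    refine le_trans (Finset.card_le_card fun t ht => ?_) (card_pow_eq_linear_le hr (-1) d)
    simp only [Finset.mem_filter, Finset.mem_univ, true_and] at ht ⊢
    rw [← hσ, ← ht]
    ring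
  have hcard : fixed.card ≤ r := by
    refine le_trans (Finset.card_le_card fun t ht => ?_) (card_pow_eq_linear_le hr (1 : F) 0)
    simpa [hfixed, hσ] using ht
  have hsum : ∑ d ∈ fixed, (Finset.univ.filter fun t : F => t + σ t = d).card = r ^ 2 := by
    rw [← hF, ← Finset.card_univ]
    refine (Finset.card_eq_sum_card_fiberwise fun t _ => ?_).symm
    simp [hfixed, hinv, add_comm]
  have hcmem : c ∈ fixed := by simpa [hfixed] using hc
  refine le_antisymm (hfiber c) (by_contra fun hlt => ?_)
  have hstrict := Finset.sum_lt_sum (fun d _ => hfiber d) ⟨c, hcmem, not_le.1 hlt⟩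
  rw [hsum, Finset.sum_const, smul_eq_mul] at hstrict
  nlinarith

end Trace

section Polarity

open Module

variable {K V : Type*} [Field K] [AddCommGroup V] [Module K V] {σ : K →+* K}

/-- A nondegenerate reflexive sesquilinear form on a space of dimension `2 * D`. -/
structure IsPolarity (h : V →ₛₗ[σ] V →ₗ[K] K) (D : ℕ) : Prop where
  isRefl : h.IsRefl
  nondegenerate : h.Nondegenerate
  finrank_eq : finrank K V = 2 * D

variable {h : V →ₛₗ[σ] V →ₗ[K] K} {D : ℕ}

theorem finrank_span_image_le [FiniteDimensional K V] (h : V →ₛₗ[σ] V →ₗ[K] K)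
    (W : Submodule K V) : finrank K (Submodule.span K (h '' W)) ≤ finrank K W := by
  let b := Module.finBasis K W
  have hspan : Submodule.span K (h '' W) ≤ Submodule.span K (Set.range fun i => h (b i)) := by
    refine Submodule.span_le.2 ?_
    rintro _ ⟨w, hw, rfl⟩
    have hrepr : h w = ∑ i, σ (b.repr ⟨w, hw⟩ i) • h (b i) := by
      conv_lhs => rw [show w = (⟨w, hw⟩ : W) from rfl, ← b.sum_repr ⟨w, hw⟩]
      simp only [AddSubmonoidClass.coe_finsetSum, Submodule.coe_smul, map_sum, map_smulₛₗ]
    rw [hrepr]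
    exact Submodule.sum_smul_mem _ _ fun i _ => Submodule.subset_span ⟨i, rfl⟩
  exact (Submodule.finrank_mono hspan).trans ((finrank_range_le_card _).trans_eq (by simp))

theorem le_finrank_add_finrank_orthogonal [FiniteDimensional K V] (h : V →ₛₗ[σ] V →ₗ[K] K)
    (W : Submodule K V) : finrank K V ≤ finrank K W + finrank K (W.orthogonalBilin h) := by
  have hco : (Submodule.span K (h '' W)).dualCoannihilator = W.orthogonalBilin h := by
    ext v
    rw [← SetLike.mem_coe, Submodule.coe_dualCoannihilator_span]
    simp [Submodule.mem_orthogonalBilin_iff]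
  rw [← Subspace.finrank_add_finrank_dualCoannihilator_eq (Submodule.span K (h '' W)), hco]
  exact Nat.add_le_add_right (finrank_span_image_le h W) _

namespace IsPolarity

theorem le_orthogonal_comm (H : IsPolarity h D) {A B : Submodule K V} :
    A ≤ B.orthogonalBilin h ↔ B ≤ A.orthogonalBilin h :=
  ⟨fun hAB _ hb _ ha => H.isRefl _ _ (hAB ha _ hb), fun hBA _ ha _ hb => H.isRefl _ _ (hBA hb _ ha)⟩

theorem orthogonal_sup (H : IsPolarity h D) (A B : Submodule K V) :
    (A ⊔ B).orthogonalBilin h = A.orthogonalBilin h ⊓ B.orthogonalBilin h :=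
  eq_of_forall_le_iff fun C => by
    rw [H.le_orthogonal_comm, sup_le_iff, le_inf_iff, H.le_orthogonal_comm (B := A),
      H.le_orthogonal_comm (B := B)]

variable [FiniteDimensional K V]

theorem finrank_add_finrank_orthogonal (H : IsPolarity h D) (W : Submodule K V) :
    finrank K W + finrank K (W.orthogonalBilin h) = 2 * D := by
  obtain ⟨W', hW⟩ := W.exists_isCompl
  have hinf : W.orthogonalBilin h ⊓ W'.orthogonalBilin h = ⊥ := by
    rw [← H.orthogonal_sup, hW.sup_eq_top, eq_bot_iff]
    exact fun v hv => H.nondegenerate.2 v fun u => hv u trivial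
  have hsum := Submodule.finrank_add_finrank_le_of_disjoint (disjoint_iff.2 hinf)
  have := le_finrank_add_finrank_orthogonal h W
  have := le_finrank_add_finrank_orthogonal h W'
  have := Submodule.finrank_add_eq_of_isCompl hW
  have := H.finrank_eq
  omega

end IsPolarity

end Polarity

namespace IsotropicSubspace

open Module

variable {K V : Type*} [Field K] [AddCommGroup V] [Module K V] [FiniteDimensional K V]
  {σ : K →+* K} {h : V →ₛₗ[σ] V →ₗ[K] K} {D : ℕ} {y z : IsotropicSubspace h D}

omit [FiniteDimensional K V] in
theorem adj_iff_finrank_inf : (dualPolarGraph h D).Adj z y ↔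
    finrank K (z.carrier ⊓ y.carrier : Submodule K V) + 1 = D := Iff.rfl

theorem eq_of_carrier_le (hyz : y.carrier ≤ z.carrier) : y = z :=
  IsotropicSubspace.ext
    (Submodule.eq_of_le_of_finrank_eq hyz (y.finrank_eq.trans z.finrank_eq.symm))

theorem inf_eq_of_le (hyz : y ≠ z) {C : Submodule K V} (hC : finrank K C + 1 = D)
    (hy : C ≤ y.carrier) (hz : C ≤ z.carrier) : z.carrier ⊓ y.carrier = C := by
  have hlt : z.carrier ⊓ y.carrier < y.carrier :=
    inf_lt_right.2 fun hle => hyz (eq_of_carrier_le hle)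
  refine (Submodule.eq_of_le_of_finrank_le (le_inf hz hy) ?_).symm
  have := Submodule.finrank_lt_finrank_of_lt hlt
  have := y.finrank_eq
  omega

theorem adj_of_le (hyz : y ≠ z) {C : Submodule K V} (hC : finrank K C + 1 = D)
    (hy : C ≤ y.carrier) (hz : C ≤ z.carrier) : (dualPolarGraph h D).Adj z y := by
  rwa [adj_iff_finrank_inf, inf_eq_of_le hyz hC hy hz]

omit [FiniteDimensional K V] in
theorem le_orthogonal (y : IsotropicSubspace h D) {U : Submodule K V} (hU : U ≤ y.carrier) :
    y.carrier ≤ U.orthogonalBilin h :=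
  fun v hv u hu => y.isotropic u (hU hu) v hv

theorem orthogonal_eq (H : IsPolarity h D) (y : IsotropicSubspace h D) :
    y.carrier.orthogonalBilin h = y.carrier := by
  refine (Submodule.eq_of_le_of_finrank_eq (y.le_orthogonal le_rfl) ?_).symm
  have := H.finrank_add_finrank_orthogonal y.carrier
  have := y.finrank_eq
  omega

theorem carrier_le_orthogonal_iff (H : IsPolarity h D) {U : Submodule K V} :
    y.carrier ≤ U.orthogonalBilin h ↔ U ≤ y.carrier := by
  rw [H.le_orthogonal_comm, y.orthogonal_eq H]

theorem finrank_inf_orthogonal (H : IsPolarity h D) (y : IsotropicSubspace h D)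
    (U : Submodule K V) :
    finrank K (y.carrier ⊓ U.orthogonalBilin h : Submodule K V) + finrank K U =
      D + finrank K (U ⊓ y.carrier : Submodule K V) := by
  have horth := H.orthogonal_sup U y.carrier
  rw [y.orthogonal_eq H, inf_comm] at horth
  have := Submodule.finrank_sup_add_finrank_inf_eq U y.carrier
  have := H.finrank_add_finrank_orthogonal (U ⊔ y.carrier)
  have := y.finrank_eq
  rw [← horth]
  omega

/-- The projection of `y` on the residue of the isotropic subspace `U`: the vertex through `U` that
is nearest to `y`. -/
def project (y : IsotropicSubspace h D) (H : IsPolarity h D) {U : Submodule K V}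
    (hU : U ≤ U.orthogonalBilin h) : IsotropicSubspace h D where
  carrier := U ⊔ (y.carrier ⊓ U.orthogonalBilin h)
  isotropic := by
    have hself : U ⊔ (y.carrier ⊓ U.orthogonalBilin h) ≤
        (U ⊔ (y.carrier ⊓ U.orthogonalBilin h)).orthogonalBilin h := by
      rw [H.orthogonal_sup]
      exact sup_le (le_inf hU (H.le_orthogonal_comm.2 inf_le_right))
        (le_inf inf_le_right (inf_le_left.trans (y.le_orthogonal inf_le_left)))
    exact fun u hu v hv => hself hv u hu
  finrank_eq := by
    have hinf : U ⊓ (y.carrier ⊓ U.orthogonalBilin h) = U ⊓ y.carrier := by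
      rw [inf_left_comm, inf_eq_left.2 hU, inf_comm]
    have hsum := Submodule.finrank_sup_add_finrank_inf_eq U (y.carrier ⊓ U.orthogonalBilin h)
    rw [hinf] at hsum
    have := y.finrank_inf_orthogonal H U
    omega

variable {U : Submodule K V}

theorem le_project (y : IsotropicSubspace h D) (H : IsPolarity h D)
    (hU : U ≤ U.orthogonalBilin h) : U ≤ (y.project H hU).carrier := le_sup_left

theorem inf_orthogonal_le_project (y : IsotropicSubspace h D) (H : IsPolarity h D)
    (hU : U ≤ U.orthogonalBilin h) :
    y.carrier ⊓ U.orthogonalBilin h ≤ (y.project H hU).carrier := le_sup_right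

theorem eq_project_of_le (H : IsPolarity h D) (hU : U ≤ U.orthogonalBilin h) (hUz : U ≤ z.carrier)
    (hyz : y.carrier ⊓ U.orthogonalBilin h ≤ z.carrier) : z = y.project H hU :=
  (eq_of_carrier_le (sup_le hUz hyz)).symm

theorem inf_eq_of_adj (H : IsPolarity h D) (hzy : (dualPolarGraph h D).Adj z y)
    (hUz : U ≤ z.carrier) (hUy : ¬ U ≤ y.carrier) :
    z.carrier ⊓ y.carrier = y.carrier ⊓ U.orthogonalBilin h := by
  refine Submodule.eq_of_le_of_finrank_le
    (le_inf inf_le_right (inf_le_left.trans (z.le_orthogonal hUz))) ?_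
  have hlt : y.carrier ⊓ U.orthogonalBilin h < y.carrier :=
    inf_lt_left.2 fun hle => hUy ((carrier_le_orthogonal_iff H).1 hle)
  have := Submodule.finrank_lt_finrank_of_lt hlt
  have := y.finrank_eq
  rw [adj_iff_finrank_inf] at hzy
  omega

theorem eq_project_of_adj (H : IsPolarity h D) (hU : U ≤ U.orthogonalBilin h)
    (hzy : (dualPolarGraph h D).Adj z y) (hUz : U ≤ z.carrier) (hUy : ¬ U ≤ y.carrier) :
    z = y.project H hU :=
  eq_project_of_le H hU hUz ((inf_eq_of_adj H hzy hUz hUy).ge.trans inf_le_left)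

theorem project_adj (H : IsPolarity h D) (hU : U ≤ U.orthogonalBilin h)
    (hUy : finrank K (U ⊓ y.carrier : Submodule K V) + 1 = finrank K U) :
    (dualPolarGraph h D).Adj (y.project H hU) y := by
  have := y.finrank_inf_orthogonal H U
  refine adj_of_le (fun he => ?_) (by omega) inf_le_left (inf_orthogonal_le_project y H hU)
  rw [inf_eq_left.2 (le_project y H hU |>.trans (congrArg carrier he).ge)] at hUy
  omega

theorem project_project (H : IsPolarity h D) {U' : Submodule K V}
    (hU : U ≤ U.orthogonalBilin h) (hU' : U' ≤ U'.orthogonalBilin h) (hUU' : U ≤ U') :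
    (y.project H hU).project H hU' = y.project H hU' := by
  refine eq_project_of_le H hU' (le_project _ H hU') ?_
  refine le_trans (le_inf ?_ inf_le_right) (inf_orthogonal_le_project _ H hU')
  exact (inf_le_inf_left _ (Submodule.orthogonalBilin_le hUU')).trans
    (inf_orthogonal_le_project y H hU)

/-- The intersection of a vertex `y` with the base vertex `x`. -/
def meet (x y : IsotropicSubspace h D) : Submodule K V := y.carrier ⊓ x.carrier

/-- `x.IsLower z y`: the neighbour `z` of `y` is one step closer to the base vertex `x`, distances
from `x` being measured by the codimension of `x.meet`. -/
def IsLower (x z y : IsotropicSubspace h D) : Prop :=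
  (dualPolarGraph h D).Adj z y ∧ finrank K (x.meet z) = finrank K (x.meet y) + 1

variable {x w p : IsotropicSubspace h D}

omit [FiniteDimensional K V] in
theorem meet_le_left (x y : IsotropicSubspace h D) : x.meet y ≤ y.carrier := inf_le_left

omit [FiniteDimensional K V] in
theorem meet_le_right (x y : IsotropicSubspace h D) : x.meet y ≤ x.carrier := inf_le_right

omit [FiniteDimensional K V] in
theorem meet_le_meet_iff : x.meet z ≤ x.meet y ↔ x.meet z ≤ y.carrier :=
  ⟨fun hle => hle.trans (x.meet_le_left y), fun hle => le_inf hle (x.meet_le_right z)⟩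

omit [FiniteDimensional K V] in
theorem isotropic_of_le (hU : U ≤ x.carrier) : U ≤ U.orthogonalBilin h :=
  hU.trans (x.le_orthogonal hU)

omit [FiniteDimensional K V] in
theorem meet_isotropic (x y : IsotropicSubspace h D) :
    x.meet y ≤ (x.meet y).orthogonalBilin h :=
  isotropic_of_le (x.meet_le_right y)

theorem finrank_meet_le_of_adj (hzy : (dualPolarGraph h D).Adj z y) :
    finrank K (x.meet z) ≤ finrank K (x.meet z ⊓ x.meet y : Submodule K V) + 1 := by
  have hinf : x.meet z ⊓ (z.carrier ⊓ y.carrier) ≤ x.meet z ⊓ x.meet y :=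
    le_inf inf_le_left (le_inf (inf_le_right.trans inf_le_right)
      (inf_le_left.trans (x.meet_le_right z)))
  have := finrank_add_finrank_le_of_le (x.meet_le_left z)
    (inf_le_left : z.carrier ⊓ y.carrier ≤ z.carrier)
  have := Submodule.finrank_mono hinf
  have := z.finrank_eq
  rw [adj_iff_finrank_inf] at hzy
  omega

theorem isLower_iff (H : IsPolarity h D) :
    x.IsLower z y ↔ (dualPolarGraph h D).Adj z y ∧ ¬ x.meet z ≤ y.carrier := by
  refine and_congr_right fun hzy => ⟨fun hdim hle => ?_, fun hzy' => ?_⟩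
  · have := Submodule.finrank_mono (meet_le_meet_iff.2 hle)
    omega
  · have hle : x.meet y ≤ x.meet z := by
      refine le_inf ?_ (x.meet_le_right y)
      rw [eq_project_of_adj H (x.meet_isotropic z) hzy (x.meet_le_left z) hzy']
      refine le_trans (le_inf (x.meet_le_left y) ?_) (inf_orthogonal_le_project y H _)
      exact (x.meet_le_right y).trans (x.le_orthogonal (x.meet_le_right z))
    have hlt : x.meet y < x.meet z := lt_of_le_not_ge hle fun hge => hzy' (meet_le_meet_iff.1 hge)
    have hdim := finrank_meet_le_of_adj (x := x) hzy
    rw [inf_eq_right.2 hle] at hdim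
    have := Submodule.finrank_lt_finrank_of_lt hlt
    omega

namespace IsLower

theorem meet_le (hzy : x.IsLower z y) : x.meet y ≤ x.meet z := by
  have hdim := finrank_meet_le_of_adj (x := x) hzy.1
  have := hzy.2
  rw [← Submodule.eq_of_le_of_finrank_le (inf_le_right : x.meet z ⊓ x.meet y ≤ _) (by omega)]
  exact inf_le_left

theorem eq_project (H : IsPolarity h D) (hzy : x.IsLower z y) :
    z = y.project H (x.meet_isotropic z) :=
  eq_project_of_adj H _ hzy.1 (x.meet_le_left z) ((isLower_iff H).1 hzy).2

theorem unique (H : IsPolarity h D) (hzy : x.IsLower z y) (hwy : x.IsLower w y)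
    (hzw : x.meet z = x.meet w) : z = w := by
  rw [hzy.eq_project H, hwy.eq_project H]
  simp only [hzw]

end IsLower

theorem exists_isLower (H : IsPolarity h D) (hUx : U ≤ x.carrier) (hyU : x.meet y ≤ U)
    (hU : finrank K U = finrank K (x.meet y) + 1) : ∃ z, x.IsLower z y ∧ x.meet z = U := by
  have hUy : U ⊓ y.carrier = x.meet y :=
    le_antisymm (le_inf inf_le_right (inf_le_left.trans hUx)) (le_inf hyU (x.meet_le_left y))
  have hmeet : x.meet (y.project H (isotropic_of_le hUx)) = U := by
    have hle : y.carrier ⊓ U.orthogonalBilin h ⊓ x.carrier ≤ U :=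
      (inf_le_inf_right _ inf_le_left).trans hyU
    exact (sup_inf_assoc_of_le _ hUx).trans (sup_eq_left.2 hle)
  refine ⟨y.project H (isotropic_of_le hUx), ⟨project_adj H _ ?_, ?_⟩, hmeet⟩
  · rw [hUy, hU]
  · rw [hmeet, hU]

/-- Both `p` and the projection of `w` on the residue of `x.meet p` are the projection of `y` on
this residue, since projections compose along `x.meet z ≤ x.meet p` and `x.meet w ≤ x.meet p`. -/
theorem IsLower.exchange (H : IsPolarity h D) (hzy : x.IsLower z y) (hpz : x.IsLower p z)
    (hwy : x.IsLower w y) (hwp : x.meet w ≤ x.meet p) : x.IsLower p w := by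
  have hp : p = w.project H (x.meet_isotropic p) := by
    rw [hwy.eq_project H, project_project H _ _ hwp,
      ← project_project H (x.meet_isotropic z) _ hpz.meet_le, ← hzy.eq_project H,
      ← hpz.eq_project H]
  have hdim : finrank K (x.meet p) = finrank K (x.meet w) + 1 := by
    have := hzy.2
    have := hpz.2
    have := hwy.2
    omega
  have hinf : x.meet p ⊓ w.carrier = x.meet w :=
    le_antisymm (le_inf inf_le_right (inf_le_left.trans (x.meet_le_right p)))
      (le_inf hwp (x.meet_le_left w))
  refine ⟨?_, hdim⟩
  rw [hp]
  exact project_adj H _ (by rw [hinf, hdim])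

namespace IsLower

omit [FiniteDimensional K V] in
theorem finrank_inf (hzy : x.IsLower z y) :
    finrank K (z.carrier ⊓ y.carrier : Submodule K V) + 1 = D := hzy.1

theorem not_meet_le_meet_of_lower (hpz : x.IsLower p z) (hpw : x.IsLower p w)
    (hzw : x.meet z ≠ x.meet w) : ¬ x.meet w ≤ x.meet z := fun hle => by
  have := hpz.2
  have := hpw.2
  exact hzw (Submodule.eq_of_le_of_finrank_eq hle (by omega)).symm

theorem meet_eq_sup (hpz : x.IsLower p z) (hpw : x.IsLower p w) (hzw : x.meet z ≠ x.meet w) :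
    x.meet p = x.meet z ⊔ x.meet w :=
  (sup_eq_of_finrank_add_one hpz.meet_le hpw.meet_le hpz.2.symm
    (not_meet_le_meet_of_lower hpz hpw hzw)).symm

theorem lower_unique (H : IsPolarity h D) {p' : IsotropicSubspace h D} (hpz : x.IsLower p z)
    (hpw : x.IsLower p w) (hpz' : x.IsLower p' z) (hpw' : x.IsLower p' w)
    (hzw : x.meet z ≠ x.meet w) : p = p' :=
  hpz.unique H hpz' (by rw [hpz.meet_eq_sup hpw hzw, hpz'.meet_eq_sup hpw' hzw])

theorem finrank_meet_inf_lt (hzy : x.IsLower z y) (hwy : x.IsLower w y)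
    (hzw : x.meet z ≠ x.meet w) :
    finrank K (x.meet z ⊓ x.meet w : Submodule K V) < finrank K (x.meet z) := by
  refine Submodule.finrank_lt_finrank_of_lt (inf_lt_left.2 fun hle => hzw ?_)
  exact Submodule.eq_of_le_of_finrank_eq hle (hzy.2.trans hwy.2.symm)

theorem meet_eq_inf (hzy : x.IsLower z y) (hwy : x.IsLower w y) (hzw : x.meet z ≠ x.meet w) :
    x.meet y = x.meet z ⊓ x.meet w := by
  refine Submodule.eq_of_le_of_finrank_le (le_inf hzy.meet_le hwy.meet_le) ?_
  have := finrank_meet_inf_lt hzy hwy hzw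
  have := hzy.2
  omega

theorem exists_lower (H : IsPolarity h D) (hzy : x.IsLower z y) (hwy : x.IsLower w y)
    (hzw : x.meet z ≠ x.meet w) : ∃ p, x.IsLower p z ∧ x.IsLower p w := by
  have hdim : finrank K (x.meet z ⊔ x.meet w : Submodule K V) = finrank K (x.meet z) + 1 := by
    have := Submodule.finrank_sup_add_finrank_inf_eq (x.meet z) (x.meet w)
    rw [← meet_eq_inf hzy hwy hzw] at this
    have := hzy.2
    have := hwy.2
    omega
  obtain ⟨p, hpz, hp⟩ := exists_isLower H (sup_le (x.meet_le_right z) (x.meet_le_right w))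
    le_sup_left hdim
  exact ⟨p, hpz, hzy.exchange H hpz hwy (hp ▸ le_sup_right)⟩

theorem inf_le_lower (H : IsPolarity h D) (hpz : x.IsLower p z) (hpw : x.IsLower p w)
    (hzw : x.meet z ≠ x.meet w) : z.carrier ⊓ w.carrier ≤ p.carrier := by
  refine le_trans (le_inf inf_le_left ?_) ((inf_eq_of_adj H hpz.1 (x.meet_le_left p)
    ((isLower_iff H).1 hpz).2).ge.trans inf_le_left)
  rw [hpz.meet_eq_sup hpw hzw, H.orthogonal_sup]
  exact inf_le_inf (z.le_orthogonal (x.meet_le_left z)) (w.le_orthogonal (x.meet_le_left w))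

theorem finrank_inf_of_lower (H : IsPolarity h D) (hpz : x.IsLower p z) (hpw : x.IsLower p w)
    (hzw : x.meet z ≠ x.meet w) :
    finrank K (z.carrier ⊓ w.carrier : Submodule K V) + 2 = D := by
  have hlt : z.carrier ⊓ w.carrier < p.carrier ⊓ z.carrier := by
    refine lt_of_le_not_ge (le_inf (inf_le_lower H hpz hpw hzw) inf_le_left) fun hge => ?_
    refine not_meet_le_meet_of_lower hpw hpz hzw.symm (meet_le_meet_iff.2 ?_)
    exact (le_inf (hpz.meet_le.trans (x.meet_le_left p)) (x.meet_le_left z)).trans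
      (hge.trans inf_le_right)
  have hinf : p.carrier ⊓ z.carrier ⊓ (p.carrier ⊓ w.carrier) ≤ z.carrier ⊓ w.carrier :=
    inf_le_inf inf_le_right inf_le_right
  have := finrank_add_finrank_le_of_le (inf_le_left : p.carrier ⊓ z.carrier ≤ p.carrier)
    (inf_le_left : p.carrier ⊓ w.carrier ≤ p.carrier)
  have := Submodule.finrank_mono hinf
  have := Submodule.finrank_lt_finrank_of_lt hlt
  have := hpz.finrank_inf
  have := hpw.finrank_inf
  have := p.finrank_eq
  omega

theorem inf_le_upper (H : IsPolarity h D) (hzy : x.IsLower z y) (hwy : x.IsLower w y)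
    (hpz : x.IsLower p z) (hpw : x.IsLower p w) (hzw : x.meet z ≠ x.meet w) :
    z.carrier ⊓ w.carrier ≤ y.carrier := by
  have hinf : z.carrier ⊓ y.carrier ⊓ (w.carrier ⊓ y.carrier) ≤ z.carrier ⊓ w.carrier :=
    inf_le_inf inf_le_left inf_le_left
  have := finrank_add_finrank_le_of_le (inf_le_right : z.carrier ⊓ y.carrier ≤ y.carrier)
    (inf_le_right : w.carrier ⊓ y.carrier ≤ y.carrier)
  have := hzy.finrank_inf
  have := hwy.finrank_inf
  have := finrank_inf_of_lower H hpz hpw hzw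
  have := y.finrank_eq
  exact (Submodule.eq_of_le_of_finrank_le hinf (by omega)).ge.trans
    (inf_le_left.trans inf_le_right)

theorem not_inf_le (H : IsPolarity h D) (hzy : x.IsLower z y) (hpz : x.IsLower p z) :
    ¬ p.carrier ⊓ z.carrier ≤ y.carrier := fun hle => ((isLower_iff H).1 hzy).2 <|
  (le_inf (hpz.meet_le.trans (x.meet_le_left p)) (x.meet_le_left z)).trans hle

theorem inf_sup_meet (H : IsPolarity h D) (hpz : x.IsLower p z) (hpw : x.IsLower p w)
    (hzw : x.meet z ≠ x.meet w) :
    z.carrier ⊓ w.carrier ⊔ x.meet z = p.carrier ⊓ z.carrier := by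
  refine sup_eq_of_finrank_add_one (le_inf (inf_le_lower H hpz hpw hzw) inf_le_left)
    (le_inf (hpz.meet_le.trans (x.meet_le_left p)) (x.meet_le_left z)) ?_ fun hle =>
      not_meet_le_meet_of_lower hpw hpz hzw.symm (meet_le_meet_iff.2 (hle.trans inf_le_right))
  have := finrank_inf_of_lower H hpz hpw hzw
  have := hpz.finrank_inf
  omega

theorem eq_of_inf_eq (H : IsPolarity h D) (hpz : x.IsLower p z) (hpw : x.IsLower p w)
    (hzw : x.meet z ≠ x.meet w) {y' : IsotropicSubspace h D} (hzy : x.IsLower z y)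
    (hwy : x.IsLower w y) (hwy' : x.IsLower w y')
    (hyy' : z.carrier ⊓ y.carrier = z.carrier ⊓ y'.carrier) : y = y' := by
  have hw : ¬ z.carrier ⊓ y.carrier ≤ w.carrier := fun hle => by
    have := Submodule.finrank_mono (le_inf inf_le_left hle)
    have := hzy.finrank_inf
    have := finrank_inf_of_lower H hpz hpw hzw
    omega
  have hU := y.isotropic_of_le (inf_le_right : z.carrier ⊓ y.carrier ≤ y.carrier)
  rw [eq_project_of_adj H hU hwy.1.symm inf_le_right hw,
    eq_project_of_adj H hU hwy'.1.symm (hyy' ▸ inf_le_right) hw]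

theorem exists_upper (H : IsPolarity h D) (hpz : x.IsLower p z) (hpw : x.IsLower p w)
    (hzw : x.meet z ≠ x.meet w) {C : Submodule K V} (hC : finrank K C + 1 = D)
    (hwC : z.carrier ⊓ w.carrier ≤ C) (hCz : C ≤ z.carrier) (hpC : ¬ p.carrier ⊓ z.carrier ≤ C) :
    ∃ y, x.IsLower z y ∧ x.IsLower w y ∧ z.carrier ⊓ y.carrier = C := by
  have hCw : C ⊓ w.carrier = z.carrier ⊓ w.carrier :=
    le_antisymm (inf_le_inf_right _ hCz) (le_inf hwC inf_le_right)
  have hdim := finrank_inf_of_lower H hpz hpw hzw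
  set y := w.project H (z.isotropic_of_le hCz)
  have hyw : (dualPolarGraph h D).Adj y w := project_adj H _ (by rw [hCw]; omega)
  have hyz : y ≠ z := fun he => by
    rw [he, adj_iff_finrank_inf] at hyw
    omega
  have hCy : C ≤ y.carrier := w.le_project H _
  have hzy : z.carrier ⊓ y.carrier = C := inf_eq_of_le hyz hC hCy hCz
  refine ⟨y, (isLower_iff H).2 ⟨adj_of_le hyz hC hCy hCz, fun hle => hpC ?_⟩,
    (isLower_iff H).2 ⟨hyw.symm, fun hle => ?_⟩, hzy⟩
  · rw [← inf_sup_meet H hpz hpw hzw]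
    exact sup_le hwC (hzy ▸ le_inf (x.meet_le_left z) hle)
  · refine not_meet_le_meet_of_lower hpz hpw hzw (meet_le_meet_iff.2 ?_)
    rw [← carrier_le_orthogonal_iff H, ← sup_eq_of_finrank_add_one hCz inf_le_right
      (hC.trans z.finrank_eq.symm) hpC]
    exact sup_le (hCy.trans (y.le_orthogonal hle)) (inf_le_left.trans
      (p.le_orthogonal (hpw.meet_le.trans (x.meet_le_left p))))

end IsLower

end IsotropicSubspace

section RegularPolarity

open Module

variable {K V : Type*} [Field K] [AddCommGroup V] [Module K V] [FiniteDimensional K V]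
  {σ : K →+* K} {h : V →ₛₗ[σ] V →ₗ[K] K} {D : ℕ}

omit [FiniteDimensional K V] in
theorem span_singleton_le_orthogonal {w : V} (hw : h w w = 0) :
    Submodule.span K {w} ≤ (Submodule.span K {w}).orthogonalBilin h := by
  intro a ha b hb
  obtain ⟨a, rfl⟩ := Submodule.mem_span_singleton.1 ha
  obtain ⟨b, rfl⟩ := Submodule.mem_span_singleton.1 hb
  simp [hw]

/-- A polarity over the field with `s` elements for which every `(D - 1)`-dimensional subspace of a
vertex lies in exactly `t` further vertices: the associated polar space has order `(s, t)`. -/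
structure IsRegularPolarity (h : V →ₛₗ[σ] V →ₗ[K] K) (D s t : ℕ) : Prop
    extends IsPolarity h D where
  card_eq : Nat.card K = s
  ncard_inf_eq : ∀ (z : IsotropicSubspace h D) (C : Submodule K V), C ≤ z.carrier →
    finrank K C + 1 = D → {y : IsotropicSubspace h D | z.carrier ⊓ y.carrier = C}.ncard = t

/-- A nondegenerate Hermitian form, with respect to `a ↦ a ^ r`, on a space of dimension `2 * D`
over the field with `r ^ 2` elements. -/
structure IsHermitianForm [Fintype K] (h : V →ₛₗ[σ] V →ₗ[K] K) (D r : ℕ) : Prop where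
  card_eq : Fintype.card K = r ^ 2
  conj_eq : ∀ a, σ a = a ^ r
  symm : ∀ u v, h v u = σ (h u v)
  nondegenerate : h.Nondegenerate
  finrank_eq : finrank K V = 2 * D

namespace IsHermitianForm

variable [Fintype K] {r : ℕ} {z y : IsotropicSubspace h D} {C : Submodule K V} {u v : V}

omit [FiniteDimensional K V] in
theorem isPolarity (H : IsHermitianForm h D r) : IsPolarity h D where
  isRefl u v huv := by rw [H.symm, huv, map_zero]
  nondegenerate := H.nondegenerate
  finrank_eq := H.finrank_eq

omit [FiniteDimensional K V] in
theorem one_lt (H : IsHermitianForm h D r) : 1 < r := by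
  have hcard := Fintype.one_lt_card (α := K)
  rw [H.card_eq] at hcard
  exact lt_of_not_ge fun hr => hcard.not_ge (pow_le_one₀ (Nat.zero_le r) hr)

omit [FiniteDimensional K V] in
theorem one_lt_abs (H : IsHermitianForm h D r) {q : ℤ} (hqr : q = -(r : ℤ)) : 1 < |q| := by
  rw [hqr, abs_neg, Nat.abs_cast]
  exact_mod_cast H.one_lt

theorem exists_hyperbolic (H : IsHermitianForm h D r) (hCz : C ≤ z.carrier)
    (hC : finrank K C + 1 = D) :
    ∃ u ∈ z.carrier, ∃ v ∈ C.orthogonalBilin h, h v u = 1 := by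
  have hCz' : ¬ z.carrier ≤ C := fun hle => by
    have := Submodule.finrank_mono hle
    have := z.finrank_eq
    omega
  have horth : ¬ C.orthogonalBilin h ≤ z.carrier := fun hle => by
    have := Submodule.finrank_mono hle
    have := H.isPolarity.finrank_add_finrank_orthogonal C
    have := z.finrank_eq
    omega
  obtain ⟨u, huz, huC⟩ := SetLike.not_le_iff_exists.1 hCz'
  obtain ⟨v, hvC, hvz⟩ := SetLike.not_le_iff_exists.1 horth
  have hz : C ⊔ Submodule.span K {u} = z.carrier :=
    sup_eq_of_finrank_add_one hCz (by simpa using huz) (hC.trans z.finrank_eq.symm)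
      (by simpa using huC)
  have hvu : h v u ≠ 0 := fun h0 => hvz <| by
    have hspan : v ∈ (Submodule.span K {u}).orthogonalBilin h :=
      H.isPolarity.le_orthogonal_comm.1
        ((Submodule.span_singleton_le_iff_mem _ _).2
          (fun w hw => ?_ : u ∈ (Submodule.span K {v}).orthogonalBilin h))
        (Submodule.mem_span_singleton_self v)
    · rw [← z.orthogonal_eq H.isPolarity, ← hz, H.isPolarity.orthogonal_sup]
      exact ⟨hvC, hspan⟩
    · obtain ⟨a, rfl⟩ := Submodule.mem_span_singleton.1 hw
      simp [h0]
  exact ⟨(h v u)⁻¹ • u, z.carrier.smul_mem _ huz, v, hvC, by simp [hvu]⟩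

omit [FiniteDimensional K V] in
theorem apply_add_smul_self (H : IsHermitianForm h D r) (hu : u ∈ z.carrier) (hvu : h v u = 1)
    (t : K) : h (v + t • u) (v + t • u) = t + σ t + h v v := by
  have huv : h u v = 1 := by rw [H.symm, hvu, map_one]
  simp only [map_add, map_smulₛₗ, LinearMap.add_apply, LinearMap.smul_apply, smul_eq_mul, huv, hvu,
    z.isotropic u hu u hu, RingHom.id_apply]
  ring

omit [FiniteDimensional K V] in
theorem add_conj_eq_of_mem (H : IsHermitianForm h D r) (hu : u ∈ z.carrier) (hvu : h v u = 1)
    {t : K} (hy : v + t • u ∈ y.carrier) : t + σ t = -h v v :=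
  eq_neg_of_add_eq_zero_left
    ((H.apply_add_smul_self hu hvu t).symm.trans (y.isotropic _ hy _ hy))

theorem exists_add_smul_mem (H : IsHermitianForm h D r) (hC : finrank K C + 1 = D)
    (hu : u ∈ z.carrier) (hv : v ∈ C.orthogonalBilin h) (hvu : h v u = 1)
    (hy : z.carrier ⊓ y.carrier = C) : ∃ t : K, v + t • u ∈ y.carrier := by
  have hCz : C ≤ z.carrier := hy ▸ inf_le_left
  have huy : u ∉ y.carrier := fun huy => one_ne_zero (hvu.symm.trans
    (H.isPolarity.isRefl _ _ (hv u (hy ▸ ⟨hu, huy⟩))))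
  have hsup : y.carrier ⊔ Submodule.span K {u} = C.orthogonalBilin h := by
    refine sup_eq_of_finrank_add_one (y.le_orthogonal (hy ▸ inf_le_right))
      (by simpa using z.le_orthogonal hCz hu) ?_ (by simpa using huy)
    have := H.isPolarity.finrank_add_finrank_orthogonal C
    have := y.finrank_eq
    omega
  obtain ⟨w, hw, _, hs, hwv⟩ := Submodule.mem_sup.1 (hsup ▸ hv)
  obtain ⟨t, rfl⟩ := Submodule.mem_span_singleton.1 hs
  exact ⟨-t, by simpa [← hwv] using hw⟩

omit [FiniteDimensional K V] in
theorem eq_of_add_smul_mem (H : IsHermitianForm h D r) (hu : u ∈ z.carrier)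
    (hv : v ∈ C.orthogonalBilin h) (hvu : h v u = 1) (hy : z.carrier ⊓ y.carrier = C) {t t' : K}
    (ht : v + t • u ∈ y.carrier) (ht' : v + t' • u ∈ y.carrier) : t = t' := by
  by_contra hne
  have huy : u ∈ y.carrier := by
    have hsub := y.carrier.sub_mem ht ht'
    rwa [add_sub_add_left_eq_sub, ← sub_smul,
      Submodule.smul_mem_iff _ (sub_ne_zero.2 hne)] at hsub
  exact one_ne_zero (hvu.symm.trans (H.isPolarity.isRefl _ _ (hv u (hy ▸ ⟨hu, huy⟩))))

theorem existsUnique_add_smul_mem (H : IsHermitianForm h D r) (hCz : C ≤ z.carrier)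
    (hC : finrank K C + 1 = D) (hu : u ∈ z.carrier) (hv : v ∈ C.orthogonalBilin h)
    (hvu : h v u = 1) {t : K} (ht : t + σ t = -h v v) :
    ∃! y : IsotropicSubspace h D, z.carrier ⊓ y.carrier = C ∧ v + t • u ∈ y.carrier := by
  have hw : h (v + t • u) (v + t • u) = 0 := by
    rw [H.apply_add_smul_self hu hvu, ht, neg_add_cancel]
  have hwz : ¬ Submodule.span K {v + t • u} ≤ z.carrier := fun hle => by
    have hwu := z.isotropic _ (by simpa using hle) u hu
    rw [map_add, map_smulₛₗ, LinearMap.add_apply, LinearMap.smul_apply, z.isotropic u hu u hu, hvu,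
      smul_zero, add_zero] at hwu
    exact one_ne_zero hwu
  have hmem : v + t • u ∈ (z.project H.isPolarity (span_singleton_le_orthogonal hw)).carrier := by
    simpa using z.le_project H.isPolarity (span_singleton_le_orthogonal hw)
  refine ⟨z.project H.isPolarity (span_singleton_le_orthogonal hw), ⟨?_, hmem⟩, fun y hy => ?_⟩
  · refine IsotropicSubspace.inf_eq_of_le (fun he => hwz ?_) hC ?_ hCz
    · exact (z.le_project H.isPolarity _).trans (congrArg IsotropicSubspace.carrier he).le
    · refine le_trans (le_inf hCz ?_)
        (z.inf_orthogonal_le_project H.isPolarity (span_singleton_le_orthogonal hw))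
      rw [H.isPolarity.le_orthogonal_comm, Submodule.span_singleton_le_iff_mem]
      exact add_mem hv (Submodule.smul_mem _ t (z.le_orthogonal hCz hu))
  · refine IsotropicSubspace.eq_project_of_adj H.isPolarity _ ?_ (by simpa using hy.2) hwz
    rw [IsotropicSubspace.adj_iff_finrank_inf, inf_comm, hy.1, hC]

theorem isRegularPolarity (H : IsHermitianForm h D r) : IsRegularPolarity h D (r ^ 2) r where
  toIsPolarity := H.isPolarity
  card_eq := by rw [Nat.card_eq_fintype_card, H.card_eq]
  ncard_inf_eq z C hCz hC := by
    classical
    obtain ⟨u, hu, v, hv, hvu⟩ := H.exists_hyperbolic hCz hC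
    have hfix : σ (-h v v) = -h v v := by rw [map_neg, ← H.symm]
    rw [← card_add_conj_eq H.card_eq H.one_lt H.conj_eq hfix, ← Set.ncard_coe_finset]
    choose! τ hτ using fun y : IsotropicSubspace h D =>
      H.exists_add_smul_mem (y := y) hC hu hv hvu
    refine Set.ncard_congr (fun y _ => τ y) (fun y hy => ?_) (fun y y' hy hy' he => ?_)
      fun t ht => ?_
    · simpa using H.add_conj_eq_of_mem hu hvu (hτ y hy)
    · exact (H.existsUnique_add_smul_mem hCz hC hu hv hvu
        (H.add_conj_eq_of_mem hu hvu (hτ y hy))).unique ⟨hy, hτ y hy⟩ ⟨hy', he ▸ hτ y' hy'⟩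
    · obtain ⟨y, ⟨hy, hty⟩, -⟩ := H.existsUnique_add_smul_mem hCz hC hu hv hvu (by simpa using ht)
      exact ⟨y, hy, H.eq_of_add_smul_mem hu hv hvu hy (hτ y hy) hty⟩

end IsHermitianForm

end RegularPolarity

namespace IsotropicSubspace

open Module

section Counting

open Finset

open scoped Classical

variable {K V : Type*} [Field K] [Finite K] [AddCommGroup V] [Module K V] [FiniteDimensional K V]
  {σ : K →+* K} {h : V →ₛₗ[σ] V →ₗ[K] K} {D s t : ℕ} {x y z w p : IsotropicSubspace h D}

theorem card_adj_of_le_of_not_le (H : IsRegularPolarity h D s t) {A U : Submodule K V}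
    (hAU : A ≤ U) (hU : U ≤ z.carrier) :
    #{y | (dualPolarGraph h D).Adj z y ∧ A ≤ y.carrier ∧ ¬ U ≤ y.carrier} =
      (∑ k ∈ range (finrank K U - finrank K A), s ^ k) * s ^ (D - finrank K U) * t := by
  have hmem : ∀ y : IsotropicSubspace h D,
      z.carrier ⊓ y.carrier ∈ hyperplanesBetween A z.carrier \ hyperplanesBetween U z.carrier ↔
        (dualPolarGraph h D).Adj z y ∧ A ≤ y.carrier ∧ ¬ U ≤ y.carrier := fun y => by
    simp only [mem_sdiff, mem_hyperplanesBetween, adj_iff_finrank_inf, le_inf_iff, hU,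
      hAU.trans hU, inf_le_left, z.finrank_eq]
    tauto
  rw [card_eq_sum_card_fiberwise (f := fun y => z.carrier ⊓ y.carrier)
    (t := hyperplanesBetween A z.carrier \ hyperplanesBetween U z.carrier)
    fun y hy => (hmem y).2 (mem_filter.1 hy).2]
  rw [sum_const_nat (m := t), card_hyperplanesBetween_sdiff hAU hU, H.card_eq, z.finrank_eq]
  intro C hC
  have hC' := mem_hyperplanesBetween.1 (mem_sdiff.1 hC).1
  rw [← H.ncard_inf_eq z C hC'.2.1 (hC'.2.2.trans z.finrank_eq), ← Set.ncard_coe_finset]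
  congr 1
  ext y
  simp only [filter_filter, coe_filter, mem_univ, true_and, ← hmem]
  exact ⟨fun hy => hy.2, fun hy => ⟨by rwa [show _ = C from hy], hy⟩⟩

theorem card_upper (H : IsRegularPolarity h D s t) (x z : IsotropicSubspace h D) :
    #{y | x.IsLower z y} =
      (∑ k ∈ range (finrank K (x.meet z)), s ^ k) * s ^ (D - finrank K (x.meet z)) * t := by
  simpa [isLower_iff H.toIsPolarity] using
    card_adj_of_le_of_not_le H (bot_le : ⊥ ≤ x.meet z) (x.meet_le_left z)

theorem IsLower.card_upper_meet_eq (H : IsRegularPolarity h D s t) (hzy : x.IsLower z y) :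
    #{y' | x.IsLower z y' ∧ x.meet y' = x.meet y} = s ^ (D - finrank K (x.meet z)) * t := by
  have hcard := card_adj_of_le_of_not_le H hzy.meet_le (x.meet_le_left z)
  rw [hzy.2, Nat.add_sub_cancel_left, sum_range_one, pow_zero, one_mul, ← hzy.2] at hcard
  rw [← hcard]
  congr 1
  ext y'
  simp only [mem_filter, mem_univ, true_and, isLower_iff H.toIsPolarity, and_assoc]
  refine and_congr_right fun hadj => ⟨fun hy' => ⟨hy'.2 ▸ x.meet_le_left y', hy'.1⟩,
    fun hy' => ⟨hy'.2, ?_⟩⟩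
  have hzy' := (isLower_iff H.toIsPolarity).2 ⟨hadj, hy'.2⟩
  have hle : x.meet y ≤ x.meet y' := le_inf hy'.1 (x.meet_le_right y)
  exact (Submodule.eq_of_le_of_finrank_eq hle
    (Nat.succ_injective (hzy.2.symm.trans hzy'.2))).symm

theorem IsLower.card_between (H : IsRegularPolarity h D s t) (hzy : x.IsLower z y)
    (hpz : x.IsLower p z) :
    #{w | x.IsLower w y ∧ x.IsLower p w ∧ x.meet w ≠ x.meet z} = s := by
  have hcard := card_hyperplanesBetween_sdiff hzy.meet_le hpz.meet_le
  rw [hzy.2, hpz.2, hzy.2, Nat.add_sub_cancel_left, Nat.add_sub_cancel_left, sum_range_one,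
    pow_zero, one_mul, pow_one, H.card_eq] at hcard
  rw [← hcard]
  refine card_bij (fun w _ => x.meet w) (fun w hw => ?_) (fun w hw w' hw' he => ?_) fun U hU => ?_
  · simp only [mem_filter, mem_univ, true_and] at hw
    rw [mem_sdiff, mem_hyperplanesBetween, mem_hyperplanesBetween]
    exact ⟨⟨hw.1.meet_le, hw.2.1.meet_le, hw.2.1.2.symm⟩, fun hz => hw.2.2
      (Submodule.eq_of_le_of_finrank_eq hz.1 (hzy.2.trans hw.1.2.symm)).symm⟩
  · simp only [mem_filter, mem_univ, true_and] at hw hw'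
    exact hw.1.unique H.toIsPolarity hw'.1 he
  · rw [mem_sdiff, mem_hyperplanesBetween, mem_hyperplanesBetween] at hU
    obtain ⟨⟨hyU, hUp, hU⟩, hUz⟩ := hU
    obtain ⟨w, hwy, rfl⟩ := exists_isLower H.toIsPolarity (hUp.trans (x.meet_le_right p)) hyU
      (Nat.succ_injective (hU.trans (hpz.2.trans (congrArg (· + 1) hzy.2))))
    refine ⟨w, ?_, rfl⟩
    simp only [mem_filter, mem_univ, true_and]
    exact ⟨hwy, hzy.exchange H.toIsPolarity hpz hwy hUp, fun he => hUz ⟨he.ge, hUp, hU⟩⟩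

theorem IsLower.card_common_upper (H : IsRegularPolarity h D s t) (hpz : x.IsLower p z)
    (hpw : x.IsLower p w) (hzw : x.meet z ≠ x.meet w) :
    #{y | x.IsLower z y ∧ x.IsLower w y} = s := by
  have hcard := card_hyperplanesBetween_sdiff
    (le_inf (inf_le_lower H.toIsPolarity hpz hpw hzw) inf_le_left)
    (inf_le_right : p.carrier ⊓ z.carrier ≤ z.carrier)
  have hdim := finrank_inf_of_lower H.toIsPolarity hpz hpw hzw
  have hdim' := hpz.finrank_inf
  rw [show finrank K (p.carrier ⊓ z.carrier : Submodule K V) -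
      finrank K (z.carrier ⊓ w.carrier : Submodule K V) = 1 by omega,
    show finrank K z.carrier - finrank K (p.carrier ⊓ z.carrier : Submodule K V) = 1 by
      have := z.finrank_eq; omega,
    sum_range_one, pow_zero, one_mul, pow_one, H.card_eq] at hcard
  rw [← hcard]
  refine card_bij (fun y _ => z.carrier ⊓ y.carrier) (fun y hy => ?_) (fun y hy y' hy' he => ?_)
    fun C hC => ?_
  · simp only [mem_filter, mem_univ, true_and] at hy
    rw [mem_sdiff, mem_hyperplanesBetween, mem_hyperplanesBetween]
    exact ⟨⟨le_inf inf_le_left (inf_le_upper H.toIsPolarity hy.1 hy.2 hpz hpw hzw), inf_le_left,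
      hy.1.finrank_inf.trans z.finrank_eq.symm⟩,
      fun hle => hy.1.not_inf_le H.toIsPolarity hpz (hle.1.trans inf_le_right)⟩
  · simp only [mem_filter, mem_univ, true_and] at hy hy'
    exact eq_of_inf_eq H.toIsPolarity hpz hpw hzw hy.1 hy.2 hy'.2 he
  · rw [mem_sdiff, mem_hyperplanesBetween, mem_hyperplanesBetween] at hC
    obtain ⟨⟨hwC, hCz, hC⟩, hpC⟩ := hC
    obtain ⟨y, hzy, hwy, rfl⟩ := exists_upper H.toIsPolarity hpz hpw hzw (hC.trans z.finrank_eq)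
      hwC hCz fun hle => hpC ⟨hle, hCz, hC⟩
    exact ⟨y, by simpa using ⟨hzy, hwy⟩, rfl⟩

/-- The common upper neighbours of two vertices. -/
noncomputable def commonUpper (x z w : IsotropicSubspace h D) : Finset (IsotropicSubspace h D) :=
  {y | x.IsLower z y ∧ x.IsLower w y}

/-- The common lower neighbours of two vertices. -/
noncomputable def commonLower (x z w : IsotropicSubspace h D) : Finset (IsotropicSubspace h D) :=
  {p | x.IsLower p z ∧ x.IsLower p w}

theorem mem_commonUpper : y ∈ commonUpper x z w ↔ x.IsLower z y ∧ x.IsLower w y := by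
  simp [commonUpper]

theorem mem_commonLower : p ∈ commonLower x z w ↔ x.IsLower p z ∧ x.IsLower p w := by
  simp [commonLower]

theorem card_commonUpper (H : IsRegularPolarity h D s t) (hzw : x.meet z ≠ x.meet w) :
    #(commonUpper x z w) = s * #(commonLower x z w) := by
  by_cases hp : ∃ p, x.IsLower p z ∧ x.IsLower p w
  · obtain ⟨p, hpz, hpw⟩ := hp
    have hsingle : commonLower x z w = {p} := by
      ext p'
      rw [mem_commonLower, mem_singleton]
      refine ⟨fun hp' => hp'.1.lower_unique H.toIsPolarity hp'.2 hpz hpw hzw, ?_⟩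
      rintro rfl
      exact ⟨hpz, hpw⟩
    rw [hsingle, card_singleton, mul_one]
    exact hpz.card_common_upper H hpw hzw
  · have hlower : commonLower x z w = ∅ :=
      eq_empty_of_forall_notMem fun p hmem => hp ⟨p, mem_commonLower.1 hmem⟩
    have hupper : commonUpper x z w = ∅ := eq_empty_of_forall_notMem fun y hmem =>
      hp ((mem_commonUpper.1 hmem).1.exists_lower H.toIsPolarity (mem_commonUpper.1 hmem).2 hzw)
    rw [hlower, hupper, card_empty, mul_zero]

theorem sum_card_commonLower (x y : IsotropicSubspace h D)
    (S : Finset (IsotropicSubspace h D)) :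
    ∑ w ∈ S, #(commonLower x w y) = ∑ z with x.IsLower z y, #{w ∈ S | x.IsLower z w} := by
  refine Eq.trans (sum_congr rfl fun w _ => congrArg card ?_)
    (sum_card_bipartiteAbove_eq_sum_card_bipartiteBelow fun w z => x.IsLower z w)
  ext z
  simp only [mem_commonLower, bipartiteAbove, mem_filter, mem_univ, true_and, and_comm]

theorem IsLower.card_between_ite (H : IsRegularPolarity h D s t) (hzy : x.IsLower z y)
    (hzw : x.meet z = x.meet w) (hpw : x.IsLower p w) :
    #{z' | (x.IsLower z' y ∧ z' ≠ z) ∧ x.IsLower p z'} = if x.IsLower p z then s else 0 := by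
  split_ifs with hpz
  · rw [← hzy.card_between H hpz]
    congr 1
    ext z'
    simp only [mem_filter, mem_univ, true_and, and_assoc]
    refine and_congr_right fun hz'y => ⟨fun hz' => ⟨hz'.2, fun he => hz'.1 ?_⟩,
      fun hz' => ⟨fun he => hz'.2 (congrArg x.meet he), hz'.1⟩⟩
    exact hz'y.unique H.toIsPolarity hzy he
  · refine card_eq_zero.2 (filter_eq_empty_iff.2 fun z' _ hz' => hpz ?_)
    exact hz'.1.1.exchange H.toIsPolarity hz'.2 hzy (hzw ▸ hpw.meet_le)

theorem IsLower.sum_commonLower_ne (H : IsRegularPolarity h D s t) (hzy : x.IsLower z y)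
    (hzw : x.meet z = x.meet w) :
    ∑ z' with x.IsLower z' y ∧ z' ≠ z, #(commonLower x z' w) = s * #(commonLower x w z) := by
  rw [sum_card_commonLower]
  simp only [filter_filter]
  rw [sum_congr rfl fun p hp => hzy.card_between_ite H hzw (mem_filter.1 hp).2, ← sum_filter,
    filter_filter, sum_const, smul_eq_mul, mul_comm]
  rfl

theorem IsLower.card_upper_ite (H : IsRegularPolarity h D s t) (hzy : x.IsLower z y)
    (hzw : x.meet z = x.meet w) :
    #{y' | (x.IsLower w y' ∧ x.meet y' = x.meet y) ∧ x.IsLower z y'} =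
      if w = z then s ^ (D - finrank K (x.meet z)) * t else 0 := by
  split_ifs with hwz
  · subst hwz
    rw [← hzy.card_upper_meet_eq H]
    congr 1
    ext y'
    simp only [mem_filter, mem_univ, true_and]
    tauto
  · exact card_eq_zero.2 (filter_eq_empty_iff.2 fun y' _ hy' =>
      hwz (hy'.1.1.unique H.toIsPolarity hy'.2 hzw.symm))

theorem IsLower.card_upper_of_ne (H : IsRegularPolarity h D s t) (hzy : x.IsLower z y)
    (hzw : x.meet z = x.meet w) {z' : IsotropicSubspace h D} (hz'y : x.IsLower z' y)
    (hz' : z' ≠ z) :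
    #{y' | (x.IsLower w y' ∧ x.meet y' = x.meet y) ∧ x.IsLower z' y'} =
      s * #(commonLower x z' w) := by
  have hne : x.meet z' ≠ x.meet z := fun he => hz' (hz'y.unique H.toIsPolarity hzy he)
  rw [← card_commonUpper H (hzw ▸ hne)]
  congr 1
  ext y'
  simp only [mem_commonUpper, mem_filter, mem_univ, true_and]
  refine ⟨fun hy' => ⟨hy'.2, hy'.1.1⟩, fun hy' => ⟨⟨hy'.2, ?_⟩, hy'.1⟩⟩
  rw [meet_eq_inf hy'.1 hy'.2 (hzw ▸ hne), ← hzw, meet_eq_inf hz'y hzy hne]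

theorem IsLower.sum_upper_commonLower (H : IsRegularPolarity h D s t) (hzy : x.IsLower z y)
    (hzw : x.meet z = x.meet w) :
    ∑ y' with x.IsLower w y' ∧ x.meet y' = x.meet y, #(commonLower x y' y) =
      (if w = z then s ^ (D - finrank K (x.meet z)) * t else 0) +
        s ^ 2 * #(commonLower x w z) := by
  rw [sum_card_commonLower, ← add_sum_erase _ _ (mem_filter.2 ⟨mem_univ z, hzy⟩), filter_filter,
    hzy.card_upper_ite H hzw, sq, mul_assoc, ← hzy.sum_commonLower_ne H hzw, mul_sum]
  congr 1
  refine sum_congr (by ext; simp [and_comm]) fun z' hz' => ?_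
  rw [filter_filter, hzy.card_upper_of_ne H hzw (mem_filter.1 hz').2.1 (mem_filter.1 hz').2.2]

end Counting

section LowerMatrix

open Finset

open scoped Classical

variable {K V : Type*} [Field K] [Finite K] [AddCommGroup V] [Module K V] [FiniteDimensional K V]
  {σ : K →+* K} {h : V →ₛₗ[σ] V →ₗ[K] K} {D s t : ℕ} (F : Type*) [Field F]
  (x : IsotropicSubspace h D)

/-- The matrix of the relation `x.IsLower`; it is the lowering matrix of the dual polar graph with
respect to `x`, with entries in an arbitrary field. -/
noncomputable def lowerMatrix : Matrix (IsotropicSubspace h D) (IsotropicSubspace h D) F :=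
  Matrix.of fun z y => if x.IsLower z y then 1 else 0

/-- The part of `(x.lowerMatrix F)ᵀ * x.lowerMatrix F` that preserves the intersection with `x`. -/
noncomputable def sameMeetMatrix : Matrix (IsotropicSubspace h D) (IsotropicSubspace h D) F :=
  Matrix.of fun z w => if x.meet z = x.meet w then (#(commonLower x z w) : F) else 0

/-- The diagonal matrix of the numbers of upper neighbours. -/
noncomputable def upperDegreeMatrix : Matrix (IsotropicSubspace h D) (IsotropicSubspace h D) F :=
  Matrix.diagonal fun z => (#{y | x.IsLower z y} : F)

/-- The diagonal matrix of the numbers of upper neighbours with a prescribed intersection with `x`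
in a space of order `(s, t)`. -/
noncomputable def upperMultiplicityMatrix (s t : ℕ) :
    Matrix (IsotropicSubspace h D) (IsotropicSubspace h D) F :=
  Matrix.diagonal fun z => (s : F) ^ (D - finrank K (x.meet z)) * t

theorem lowerMatrix_mul_transpose_apply (z w : IsotropicSubspace h D) :
    (lowerMatrix F x * (lowerMatrix F x)ᵀ) z w = #(commonUpper x z w) := by
  simp [Matrix.mul_apply, lowerMatrix, commonUpper, ← ite_and, and_comm]

theorem transpose_mul_lowerMatrix_apply (z w : IsotropicSubspace h D) :
    ((lowerMatrix F x)ᵀ * lowerMatrix F x) z w = #(commonLower x z w) := by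
  simp [Matrix.mul_apply, lowerMatrix, commonLower, ← ite_and, and_comm]

theorem lowerMatrix_mul_transpose (H : IsRegularPolarity h D s t) :
    lowerMatrix F x * (lowerMatrix F x)ᵀ = upperDegreeMatrix F x +
      (s : F) • ((lowerMatrix F x)ᵀ * lowerMatrix F x) - (s : F) • sameMeetMatrix F x := by
  ext z w
  rw [Matrix.sub_apply, Matrix.add_apply, Matrix.smul_apply, Matrix.smul_apply,
    lowerMatrix_mul_transpose_apply, transpose_mul_lowerMatrix_apply, sameMeetMatrix,
    Matrix.of_apply, upperDegreeMatrix]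
  by_cases hzw : x.meet z = x.meet w
  · rw [if_pos hzw, add_sub_cancel_right]
    by_cases he : z = w
    · subst he
      simp [commonUpper]
    · have hempty : commonUpper x z w = ∅ := eq_empty_of_forall_notMem fun y hy =>
        he ((mem_commonUpper.1 hy).1.unique H.toIsPolarity (mem_commonUpper.1 hy).2 hzw)
      rw [Matrix.diagonal_apply_ne _ he, hempty, card_empty, Nat.cast_zero]
  · rw [if_neg hzw, Matrix.diagonal_apply_ne _ fun he => hzw (congrArg x.meet he),
      card_commonUpper H hzw]
    simp

variable {x} {w y z : IsotropicSubspace h D}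

theorem lowerMatrix_mul_sameMeetMatrix_apply :
    (lowerMatrix F x * sameMeetMatrix F x) w y =
      (∑ y' with x.IsLower w y' ∧ x.meet y' = x.meet y, #(commonLower x y' y) : ℕ) := by
  simp only [Matrix.mul_apply, lowerMatrix, sameMeetMatrix, Matrix.of_apply, sum_filter,
    Nat.cast_sum, Nat.cast_ite, Nat.cast_zero, ite_mul, one_mul, zero_mul, ite_and]

theorem sameMeetMatrix_mul_lowerMatrix_apply :
    (sameMeetMatrix F x * lowerMatrix F x) w y =
      (∑ z with x.IsLower z y ∧ x.meet w = x.meet z, #(commonLower x w z) : ℕ) := by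
  simp only [Matrix.mul_apply, lowerMatrix, sameMeetMatrix, Matrix.of_apply, sum_filter,
    Nat.cast_sum, Nat.cast_ite, Nat.cast_zero, mul_ite, mul_one, mul_zero, ite_and]

theorem IsLower.filter_isLower_meet_eq (H : IsPolarity h D) (hzy : x.IsLower z y)
    (hzw : x.meet z = x.meet w) :
    (univ.filter fun z' => x.IsLower z' y ∧ x.meet w = x.meet z') = {z} := by
  ext z'
  simp only [mem_filter, mem_univ, true_and, mem_singleton]
  refine ⟨fun hz' => hz'.1.unique H hzy (hz'.2.symm.trans hzw.symm), ?_⟩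
  rintro rfl
  exact ⟨hzy, hzw.symm⟩

theorem lowerMatrix_mul_sameMeetMatrix (H : IsRegularPolarity h D s t) :
    lowerMatrix F x * sameMeetMatrix F x = upperMultiplicityMatrix F x s t * lowerMatrix F x +
      (s : F) ^ 2 • (sameMeetMatrix F x * lowerMatrix F x) := by
  ext w y
  rw [Matrix.add_apply, Matrix.smul_apply, upperMultiplicityMatrix, Matrix.diagonal_mul,
    lowerMatrix_mul_sameMeetMatrix_apply, sameMeetMatrix_mul_lowerMatrix_apply]
  by_cases hz : ∃ z, x.IsLower z y ∧ x.meet z = x.meet w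
  · obtain ⟨z, hzy, hzw⟩ := hz
    have hwy : x.IsLower w y ↔ w = z :=
      ⟨fun hwy => hwy.unique H.toIsPolarity hzy hzw.symm, fun he => he ▸ hzy⟩
    rw [hzy.sum_upper_commonLower H hzw, hzy.filter_isLower_meet_eq H.toIsPolarity hzw,
      sum_singleton, lowerMatrix, Matrix.of_apply]
    rw [hzw]
    simp only [hwy]
    split_ifs <;> simp
  · have hupper : ∀ y', ¬ (x.IsLower w y' ∧ x.meet y' = x.meet y) := fun y' hy' => by
      obtain ⟨z, hzy, hzw⟩ := exists_isLower H.toIsPolarity (x.meet_le_right w)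
        (hy'.2 ▸ hy'.1.meet_le) (hy'.2 ▸ hy'.1.2)
      exact hz ⟨z, hzy, hzw⟩
    have hlower : ∀ z, ¬ (x.IsLower z y ∧ x.meet w = x.meet z) :=
      fun z hzy => hz ⟨z, hzy.1, hzy.2.symm⟩
    have hwy : ¬ x.IsLower w y := fun hwy => hz ⟨w, hwy, rfl⟩
    simp [hupper, hlower, hwy, lowerMatrix]

variable (x)

theorem diagonal_relation (H : IsRegularPolarity h D s t) (hs : (s : F) ≠ 0) :
    (s : F) • (upperDegreeMatrix F x * lowerMatrix F x) -
      (s : F)⁻¹ • (lowerMatrix F x * upperDegreeMatrix F x) +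
      upperMultiplicityMatrix F x s t * lowerMatrix F x =
    (((s : F) + 1) * (t * (s : F) ^ (D - 1))) • lowerMatrix F x := by
  ext w y
  simp only [Matrix.add_apply, Matrix.sub_apply, Matrix.smul_apply, upperDegreeMatrix,
    upperMultiplicityMatrix, Matrix.diagonal_mul, Matrix.mul_diagonal, smul_eq_mul]
  by_cases hwy : x.IsLower w y
  · obtain ⟨n, hn⟩ : ∃ n, D = finrank K (x.meet w) + n :=
      Nat.exists_eq_add_of_le ((Submodule.finrank_mono (x.meet_le_left w)).trans_eq w.finrank_eq)
    have hk := hwy.2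
    have hdim : D - finrank K (x.meet w) = n := by omega
    have hdim' : D - finrank K (x.meet y) = n + 1 := by omega
    have hD : D - 1 = finrank K (x.meet y) + n := by omega
    rw [card_upper H x w, card_upper H x y, hdim, hdim', hD, hk, sum_range_succ]
    set k := finrank K (x.meet y)
    have hgeom : (∑ i ∈ range k, (s : F) ^ i) * (s - 1) = s ^ k - 1 := geom_sum_mul _ _
    simp only [lowerMatrix, Matrix.of_apply, if_pos hwy]
    push_cast
    field_simp
    linear_combination (s : F) * (s : F) ^ n * t * hgeom
  · simp [lowerMatrix, hwy]

theorem lowerMatrix_relation (H : IsRegularPolarity h D s t) (hs : (s : F) ≠ 0) :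
    -((s : F) ^ 2) • ((lowerMatrix F x)ᵀ * (lowerMatrix F x * lowerMatrix F x)) +
      ((s : F) + 1) • (lowerMatrix F x * (lowerMatrix F x)ᵀ * lowerMatrix F x) -
      (s : F)⁻¹ • (lowerMatrix F x * lowerMatrix F x * (lowerMatrix F x)ᵀ) =
    (((s : F) + 1) * (t * (s : F) ^ (D - 1))) • lowerMatrix F x := by
  have hI := lowerMatrix_mul_transpose F x H
  have hII := lowerMatrix_mul_sameMeetMatrix F (x := x) H
  rw [← diagonal_relation F x H hs]
  set L := lowerMatrix F x
  set P := sameMeetMatrix F x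
  set Δ := upperDegreeMatrix F x
  have hLLTL : L * Lᵀ * L = Δ * L + (s : F) • (Lᵀ * (L * L)) - (s : F) • (P * L) := by
    rw [hI, sub_mul, add_mul, smul_mul_assoc, smul_mul_assoc, mul_assoc]
  have hLLLT : L * L * Lᵀ = L * Δ + (s : F) • (L * Lᵀ * L) - (s : F) • (L * P) := by
    simpa only [mul_sub, mul_add, mul_smul_comm, ← mul_assoc] using congrArg (L * ·) hI
  rw [hLLLT, hII, hLLTL]
  match_scalars <;> field_simp <;> ring

end LowerMatrix

end IsotropicSubspace

section Grading

open SimpleGraph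

variable {X : Type*} {G : SimpleGraph X} {x : X} {ρ : X → ℕ}

/-- A local certificate that `ρ` is the distance from `x` in a connected graph `G`; deleting the
edges inside the levels of `ρ` preserves it. -/
structure IsGradingFrom (G : SimpleGraph X) (x : X) (ρ : X → ℕ) : Prop where
  base_eq : ρ x = 0
  le_add_one : ∀ y z, G.Adj y z → ρ z ≤ ρ y + 1
  exists_adj : ∀ y, y ≠ x → ∃ z, G.Adj z y ∧ ρ y = ρ z + 1

namespace IsGradingFrom

theorem exists_walk_length_eq (H : IsGradingFrom G x ρ) {n : ℕ} {y : X} (hy : ρ y = n) :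
    ∃ p : G.Walk x y, p.length = n := by
  induction n generalizing y with
  | zero =>
    obtain rfl : y = x := by
      by_contra hyx
      obtain ⟨z, -, hz⟩ := H.exists_adj y hyx
      omega
    exact ⟨Walk.nil, rfl⟩
  | succ n ih =>
    obtain ⟨z, hzy, hz⟩ := H.exists_adj y (by rintro rfl; have := H.base_eq; omega)
    obtain ⟨p, hp⟩ := ih (by omega : ρ z = n)
    exact ⟨p.concat hzy, by rw [Walk.length_concat, hp]⟩

theorem connected (H : IsGradingFrom G x ρ) : G.Connected := by
  refine (connected_iff_exists_forall_reachable G).2 ⟨x, fun y => ?_⟩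
  obtain ⟨p, -⟩ := H.exists_walk_length_eq (rfl : ρ y = _)
  exact p.reachable

theorem le_add_length (H : IsGradingFrom G x ρ) {y z : X} (p : G.Walk y z) :
    ρ z ≤ ρ y + p.length := by
  induction p with
  | nil => simp
  | cons hyz p ih =>
    have := H.le_add_one _ _ hyz
    rw [Walk.length_cons]
    omega

theorem dist_eq (H : IsGradingFrom G x ρ) (y : X) : G.dist x y = ρ y := by
  obtain ⟨p, hp⟩ := H.exists_walk_length_eq (rfl : ρ y = _)
  refine le_antisymm (hp ▸ dist_le p) ?_
  obtain ⟨p', hp'⟩ := p.reachable.exists_walk_length_eq_dist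
  simpa [H.base_eq, hp'] using H.le_add_length p'

theorem edist_eq (H : IsGradingFrom G x ρ) (y : X) : G.edist x y = ρ y := by
  rw [← (H.connected x y).coe_dist_eq_edist, H.dist_eq]

theorem eccent_eq (H : IsGradingFrom G x ρ) {D : ℕ} (hle : ∀ y, ρ y ≤ D) (hex : ∃ y, ρ y = D) :
    G.eccent x = D := by
  refine le_antisymm ((eccent_le_iff x D).2 fun y => ?_) ?_
  · rw [H.edist_eq]
    exact_mod_cast hle y
  · obtain ⟨y, hy⟩ := hex
    rw [← hy, ← H.edist_eq]
    exact edist_le_eccent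

theorem le_toNat_eccent [Finite X] (H : IsGradingFrom G x ρ) (y : X) :
    ρ y ≤ (G.eccent x).toNat := by
  obtain ⟨z, hz⟩ := exists_edist_eq_eccent_of_finite (G := G) x
  have hyz : G.edist x y ≤ G.edist x z := edist_le_eccent.trans_eq hz.symm
  rw [H.edist_eq, H.edist_eq] at hyz
  rw [← hz, H.edist_eq, ENat.toNat_natCast]
  exact_mod_cast hyz

theorem flatDeleted_adj (H : IsGradingFrom G x ρ) {y z : X} (hyz : ρ z = ρ y + 1) :
    (G.flatDeleted x).Adj y z ↔ G.Adj y z :=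
  and_iff_left (by rw [H.dist_eq, H.dist_eq]; omega)

theorem flatDeleted (H : IsGradingFrom G x ρ) : IsGradingFrom (G.flatDeleted x) x ρ where
  base_eq := H.base_eq
  le_add_one y z hyz := H.le_add_one y z hyz.1
  exists_adj y hyx := by
    obtain ⟨z, hzy, hz⟩ := H.exists_adj y hyx
    exact ⟨z, (H.flatDeleted_adj hz).2 hzy, hz⟩

theorem isBipartite_flatDeleted (H : IsGradingFrom G x ρ) : (G.flatDeleted x).IsBipartite := by
  refine ⟨Coloring.mk (fun y => (⟨ρ y % 2, Nat.mod_lt _ two_pos⟩ : Fin 2)) fun {y z} hyz he => ?_⟩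
  have hne : ρ y ≠ ρ z := by simpa only [H.dist_eq] using hyz.2
  have h1 := H.le_add_one y z hyz.1
  have h2 := H.le_add_one z y hyz.1.symm
  rw [Fin.mk.injEq] at he
  omega

variable [Fintype X]

theorem dualIdempotent_mul_adjMatrix_mul_apply [DecidableRel G.Adj] (H : IsGradingFrom G x ρ)
    (i j : ℕ) (z y : X) :
    (G.dualIdempotent x i * G.adjMatrix ℂ * G.dualIdempotent x j) z y =
      if G.Adj z y ∧ ρ z = i ∧ ρ y = j then 1 else 0 := by
  classical
  rw [dualIdempotent, dualIdempotent, Matrix.mul_diagonal, Matrix.diagonal_mul, adjMatrix_apply,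
    H.dist_eq, H.dist_eq]
  split_ifs <;> simp_all

open scoped Classical in
theorem loweringMatrix_eq (H : IsGradingFrom G x ρ) :
    G.loweringMatrix x = Matrix.of fun z y => if G.Adj z y ∧ ρ y = ρ z + 1 then 1 else 0 := by
  ext z y
  have hy := H.le_toNat_eccent y
  simp only [loweringMatrix, Matrix.sum_apply, H.dualIdempotent_mul_adjMatrix_mul_apply,
    Matrix.of_apply]
  by_cases hzy : G.Adj z y ∧ ρ y = ρ z + 1
  · rw [if_pos hzy, Finset.sum_eq_single (ρ y) (fun i _ hi => if_neg fun hc => hi hc.2.2.symm),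
      if_pos ⟨hzy.1, by omega, rfl⟩]
    exact fun hn => absurd (Finset.mem_Icc.2 ⟨by omega, hy⟩) hn
  · rw [if_neg hzy]
    refine Finset.sum_eq_zero fun i hi => if_neg fun hc => hzy ⟨hc.1, ?_⟩
    rw [Finset.mem_Icc] at hi
    omega

theorem raisingMatrix_eq (H : IsGradingFrom G x ρ) :
    G.raisingMatrix x = (G.loweringMatrix x)ᵀ := by
  classical
  ext z y
  have hz := H.le_toNat_eccent z
  rw [H.loweringMatrix_eq]
  simp only [raisingMatrix, Matrix.sum_apply, H.dualIdempotent_mul_adjMatrix_mul_apply,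
    Matrix.transpose_apply, Matrix.of_apply, G.adj_comm z y]
  by_cases hyz : G.Adj y z ∧ ρ z = ρ y + 1
  · rw [if_pos hyz, Finset.sum_eq_single (ρ y) (fun i _ hi => if_neg fun hc => hi hc.2.2.symm),
      if_pos ⟨hyz.1, hyz.2, rfl⟩]
    exact fun hn => absurd (Finset.mem_range.2 (by omega)) hn
  · rw [if_neg hyz]
    exact Finset.sum_eq_zero fun i _ => if_neg fun hc => hyz ⟨hc.1, by omega⟩

theorem loweringMatrix_flatDeleted (H : IsGradingFrom G x ρ) :
    (G.flatDeleted x).loweringMatrix x = G.loweringMatrix x := by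
  rw [H.loweringMatrix_eq, H.flatDeleted.loweringMatrix_eq]
  ext z y
  simp only [Matrix.of_apply]
  congr 1
  exact propext (and_congr_left H.flatDeleted_adj)

theorem subconstituent_flatDeleted (H : IsGradingFrom G x ρ) (i : ℕ) :
    (G.flatDeleted x).subconstituent x i = G.subconstituent x i := by
  simp only [subconstituent, dualIdempotent, H.dist_eq, H.flatDeleted.dist_eq]

theorem uniformEquationOn_flatDeleted (H : IsGradingFrom G x ρ) {i : ℕ} {em ep f : ℂ} :
    (G.flatDeleted x).UniformEquationOn x i em ep f ↔ G.UniformEquationOn x i em ep f := by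
  simp only [UniformEquationOn, H.raisingMatrix_eq, H.flatDeleted.raisingMatrix_eq,
    H.loweringMatrix_flatDeleted, H.subconstituent_flatDeleted]

theorem mulVec_eq_zero (H : IsGradingFrom G x ρ) {i : ℕ} {v : X → ℂ}
    (hv : v ∈ G.subconstituent x i) {M : Matrix X X ℂ} (hM : ∀ z y, ρ y = i → M z y = 0) :
    M *ᵥ v = 0 := by
  classical
  obtain ⟨w, rfl⟩ := hv
  ext z
  rw [Matrix.mulVecLin_apply, Matrix.mulVec, dotProduct]
  refine Finset.sum_eq_zero fun y _ => ?_
  rw [dualIdempotent, Matrix.mulVec_diagonal, H.dist_eq]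
  split_ifs with hy
  · rw [hM z y hy, zero_mul]
  · rw [zero_mul, mul_zero]

theorem lowering_lowering_mulVec (H : IsGradingFrom G x ρ) {v : X → ℂ} {i : ℕ}
    (hv : v ∈ G.subconstituent x i) (hi : i < 2) :
    (G.loweringMatrix x * G.loweringMatrix x) *ᵥ v = 0 := by
  refine H.mulVec_eq_zero hv fun z y hy => ?_
  rw [H.loweringMatrix_eq, Matrix.mul_apply]
  refine Finset.sum_eq_zero fun w _ => ?_
  rw [Matrix.of_apply, Matrix.of_apply, ite_zero_mul_ite_zero]
  exact if_neg fun hc => by omega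

theorem raising_mulVec (H : IsGradingFrom G x ρ) {v : X → ℂ} {i : ℕ}
    (hv : v ∈ G.subconstituent x i) (hi : ∀ y, ρ y ≤ i) : G.raisingMatrix x *ᵥ v = 0 := by
  refine H.mulVec_eq_zero hv fun z y hy => ?_
  rw [H.raisingMatrix_eq, H.loweringMatrix_eq, Matrix.transpose_apply, Matrix.of_apply]
  exact if_neg fun hc => by have := hi z; omega

theorem uniformEquationOn_congr (H : IsGradingFrom G x ρ) {i : ℕ} {em ep em' ep' f : ℂ}
    (h : G.UniformEquationOn x i em ep f) (hem : 2 ≤ i → em' = em)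
    (hep : ∀ y, i < ρ y → ep' = ep) : G.UniformEquationOn x i em' ep' f := by
  intro v hv
  rw [← h v hv]
  simp only [Matrix.add_mulVec, Matrix.smul_mulVec]
  congr 1
  · congr 1
    by_cases hi : 2 ≤ i
    · rw [hem hi]
    · rw [← Matrix.mulVec_mulVec, H.lowering_lowering_mulVec hv (not_le.1 hi), Matrix.mulVec_zero,
        smul_zero, smul_zero]
  · by_cases hi : ∃ y, i < ρ y
    · obtain ⟨y, hy⟩ := hi
      rw [hep y hy]
    · rw [← Matrix.mulVec_mulVec, H.raising_mulVec hv (by simpa using hi), Matrix.mulVec_zero,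
        smul_zero, smul_zero]

end IsGradingFrom

end Grading

section ParameterMatrix

open SimpleGraph Finset

theorem det_ne_zero_of_sum_row_mul_lt_diag {ι 𝕜 : Type*} [Fintype ι] [DecidableEq ι]
    [NormedField 𝕜] {A : Matrix ι ι 𝕜} (d : ι → 𝕜)
    (h : ∀ i, ∑ j ∈ univ.erase i, ‖A i j * d j‖ < ‖A i i * d i‖) : A.det ≠ 0 := by
  have hdet : (A * Matrix.diagonal d).det ≠ 0 :=
    det_ne_zero_of_sum_row_lt_diag fun i => by simpa only [Matrix.mul_diagonal] using h i
  exact left_ne_zero_of_mul (Matrix.det_mul A _ ▸ hdet)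

theorem card_adjacent_le {ι : Type*} [Fintype ι] {f : ι → ℕ} (hf : Function.Injective f) (k : ℕ) :
    #{j | k = f j + 1 ∨ f j = k + 1} ≤ 2 := by
  refine (card_le_card_of_injOn (t := {k - 1, k + 1}) f (fun j hj => ?_) hf.injOn).trans
    card_le_two
  simp only [coe_filter, Set.mem_ofPred_eq, mem_univ, true_and] at hj
  simp only [coe_insert, coe_singleton, Set.mem_insert_iff, Set.mem_singleton_iff]
  omega

theorem det_submatrix_ne_zero_of_tridiagonal {𝕜 ι : Type*} [NormedField 𝕜] [Fintype ι]
    [DecidableEq ι] {n : ℕ} {U : Matrix (Fin n) (Fin n) 𝕜} {f : ι → Fin n}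
    (hf : Function.Injective f)
    (htri : ∀ i j : Fin n, (i : ℕ) + 1 < j ∨ (j : ℕ) + 1 < i → U i j = 0)
    (hdiag : ∀ i, U i i = 1) {d : Fin n → 𝕜} (hd : ∀ i, d i ≠ 0) {a : ℝ} (ha : 2 * a < 1)
    (hoff : ∀ i j : Fin n, (i : ℕ) = j + 1 ∨ (j : ℕ) = i + 1 → ‖U i j * d j‖ ≤ a * ‖d i‖) :
    (U.submatrix f f).det ≠ 0 := by
  refine det_ne_zero_of_sum_row_mul_lt_diag (d ∘ f) fun i => ?_
  have hterm : ∀ j ∈ univ.erase i, ‖U (f i) (f j) * d (f j)‖ ≤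
      if (f i : ℕ) = f j + 1 ∨ (f j : ℕ) = f i + 1 then a * ‖d (f i)‖ else 0 := fun j hj => by
    split_ifs with hij
    · exact hoff _ _ hij
    · have hne := Fin.val_injective.ne (hf.ne (ne_of_mem_erase hj))
      rw [htri _ _ (by omega), zero_mul, norm_zero]
  have hcard : (#{j ∈ univ.erase i | (f i : ℕ) = f j + 1 ∨ (f j : ℕ) = f i + 1} : ℝ) * a < 1 := by
    have hle := (card_le_card (filter_subset_filter _ (erase_subset i univ))).trans
      (card_adjacent_le (Fin.val_injective.comp hf) (f i))
    simp only [Function.comp_apply] at hle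
    interval_cases #{j ∈ univ.erase i | (f i : ℕ) = f j + 1 ∨ (f j : ℕ) = f i + 1} <;>
      norm_num <;> linarith
  calc ∑ j ∈ univ.erase i, ‖U (f i) (f j) * d (f j)‖
      ≤ #{j ∈ univ.erase i | (f i : ℕ) = f j + 1 ∨ (f j : ℕ) = f i + 1} * a * ‖d (f i)‖ := by
        refine (sum_le_sum hterm).trans_eq ?_
        rw [← sum_filter, sum_const, nsmul_eq_mul, mul_assoc]
    _ < 1 * ‖d (f i)‖ := mul_lt_mul_of_pos_right hcard (norm_pos_iff.2 (hd _))
    _ = ‖U (f i) (f i) * d (f i)‖ := by rw [hdiag]; simp only [norm_mul, norm_one]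

theorem eMinus_dualPolarParameterMatrix (q : ℤ) {D i : ℕ} (h2 : 2 ≤ i) (hi : i ≤ D) :
    eMinus (dualPolarParameterMatrix q D) i = -((q : ℂ) ^ 4 / ((q : ℂ) ^ 2 + 1)) := by
  rw [eMinus, entryFromOne, dif_pos (by omega), dualPolarParameterMatrix, Matrix.of_apply,
    if_neg (by rw [Fin.mk.injEq]; omega), if_pos (by simp only; omega)]

theorem ePlus_dualPolarParameterMatrix (q : ℤ) {D i : ℕ} (h1 : 1 ≤ i) (hi : i + 1 ≤ D) :
    ePlus (dualPolarParameterMatrix q D) i =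
      -((q : ℂ) ^ (-2 : ℤ) / ((q : ℂ) ^ 2 + 1)) := by
  rw [ePlus, entryFromOne, dif_pos (by omega), dualPolarParameterMatrix, Matrix.of_apply,
    if_neg (by rw [Fin.mk.injEq]; omega), if_neg (by simp only; omega),
    if_pos (by simp only; omega)]

theorem intCast_sq_add_one_ne_zero (q : ℤ) : (q : ℂ) ^ 2 + 1 ≠ 0 := by
  exact_mod_cast (by positivity : q ^ 2 + 1 ≠ 0)

theorem eMinus_dualPolarParameterMatrix_ne_zero {q : ℤ} (hq : q ≠ 0) {D i : ℕ} (h2 : 2 ≤ i)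
    (hi : i ≤ D) : eMinus (dualPolarParameterMatrix q D) i ≠ 0 := by
  rw [eMinus_dualPolarParameterMatrix q h2 hi]
  exact neg_ne_zero.2 (div_ne_zero (pow_ne_zero _ (Int.cast_ne_zero.2 hq))
    (intCast_sq_add_one_ne_zero q))

theorem ePlus_dualPolarParameterMatrix_ne_zero {q : ℤ} (hq : q ≠ 0) {D i : ℕ} (h1 : 1 ≤ i)
    (hi : i + 1 ≤ D) : ePlus (dualPolarParameterMatrix q D) i ≠ 0 := by
  rw [ePlus_dualPolarParameterMatrix q h1 hi]
  exact neg_ne_zero.2 (div_ne_zero (zpow_ne_zero _ (Int.cast_ne_zero.2 hq))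
    (intCast_sq_add_one_ne_zero q))

theorem norm_intCast_sq_add_one (q : ℤ) : ‖(q : ℂ) ^ 2 + 1‖ = ‖(q : ℂ)‖ ^ 2 + 1 := by
  have h : (q : ℂ) ^ 2 + 1 = (((q : ℝ) ^ 2 + 1 : ℝ) : ℂ) := by push_cast; rfl
  rw [h, Complex.norm_of_nonneg (by positivity), Complex.norm_intCast, sq_abs]

theorem norm_dualPolarParameterMatrix_mul {q : ℤ} (hq : q ≠ 0) {D : ℕ} {i j : Fin D}
    (hij : (i : ℕ) = j + 1 ∨ (j : ℕ) = i + 1) :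
    ‖dualPolarParameterMatrix q D i j * (q : ℂ) ^ (3 * (j : ℕ))‖ =
      ‖(q : ℂ)‖ / (‖(q : ℂ)‖ ^ 2 + 1) * ‖(q : ℂ) ^ (3 * (i : ℕ))‖ := by
  have hq0 : ‖(q : ℂ)‖ ≠ 0 := norm_ne_zero_iff.2 (Int.cast_ne_zero.2 hq)
  rw [dualPolarParameterMatrix, Matrix.of_apply, if_neg (by rintro rfl; omega)]
  rcases hij with hij | hij
  · rw [if_pos hij, norm_mul, norm_neg, norm_div, norm_pow, norm_pow, norm_pow,
      norm_intCast_sq_add_one, hij]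
    ring
  · rw [if_neg (by omega), if_pos hij, norm_mul, norm_neg, norm_div, norm_zpow, norm_pow,
      norm_pow, norm_intCast_sq_add_one, hij, _root_.zpow_neg, zpow_ofNat]
    field_simp
    ring

/-- Scaling column `j` by `q ^ (3 * j)` turns both off-diagonal entries of a row into multiples of
the diagonal one by a factor of absolute value `|q| / (q ^ 2 + 1) < 1 / 2`. -/
theorem isParameterMatrix_dualPolarParameterMatrix {q : ℤ} (hq : 1 < |q|) (D : ℕ) :
    IsParameterMatrix (dualPolarParameterMatrix q D) := by
  have hq0 : q ≠ 0 := by rintro rfl; simp at hq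
  have hnorm : 1 < ‖(q : ℂ)‖ := by rw [Complex.norm_intCast]; exact_mod_cast hq
  have htri : ∀ i j : Fin D, (i : ℕ) + 1 < j ∨ (j : ℕ) + 1 < i →
      dualPolarParameterMatrix q D i j = 0 := fun i j hij => by
    rw [dualPolarParameterMatrix, Matrix.of_apply, if_neg (by rintro rfl; omega),
      if_neg (by omega), if_neg (by omega)]
  have hdiag : ∀ i, dualPolarParameterMatrix q D i i = 1 := fun i => if_pos rfl
  refine ⟨htri, hdiag, Or.inl fun i => eMinus_dualPolarParameterMatrix_ne_zero hq0,
    fun s t _ => det_submatrix_ne_zero_of_tridiagonal Subtype.val_injective htri hdiag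
      (fun i => pow_ne_zero _ (Int.cast_ne_zero.2 hq0)) ?_
      fun i j hij => (norm_dualPolarParameterMatrix_mul hq0 hij).le⟩
  rw [← mul_div_assoc, div_lt_one (by positivity)]
  nlinarith

end ParameterMatrix

namespace IsotropicSubspace

open Module SimpleGraph

section Distance

variable {K V : Type*} [Field K] [AddCommGroup V] [Module K V] [FiniteDimensional K V]
  {σ : K →+* K} {h : V →ₛₗ[σ] V →ₗ[K] K} {D s t : ℕ}

/-- The codimension of `x.meet y` in `y`; it is the distance between `x` and `y` in the dual polar
graph. -/
noncomputable def meetCodim (x y : IsotropicSubspace h D) : ℕ := D - finrank K (x.meet y)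

theorem finrank_meet_add_meetCodim (x y : IsotropicSubspace h D) :
    finrank K (x.meet y) + x.meetCodim y = D :=
  Nat.add_sub_cancel' ((Submodule.finrank_mono (x.meet_le_left y)).trans_eq y.finrank_eq)

theorem isLower_iff_meetCodim {x y z : IsotropicSubspace h D} :
    x.IsLower z y ↔ (dualPolarGraph h D).Adj z y ∧ x.meetCodim y = x.meetCodim z + 1 := by
  have := x.finrank_meet_add_meetCodim y
  have := x.finrank_meet_add_meetCodim z
  exact and_congr_right fun _ => by omega

omit [FiniteDimensional K V] in
theorem meetCodim_self (x : IsotropicSubspace h D) : x.meetCodim x = 0 := by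
  rw [meetCodim, meet, inf_idem, x.finrank_eq, Nat.sub_self]

theorem exists_isLower_of_ne (H : IsPolarity h D) {x y : IsotropicSubspace h D} (hyx : y ≠ x) :
    ∃ z, x.IsLower z y := by
  obtain ⟨v, hvx, hvy⟩ : ∃ v ∈ x.carrier, v ∉ x.meet y := SetLike.not_le_iff_exists.1 fun hle =>
    hyx (eq_of_carrier_le (hle.trans (x.meet_le_left y))).symm
  obtain ⟨z, hzy, -⟩ := exists_isLower H (U := x.meet y ⊔ (K ∙ v))
    (sup_le (x.meet_le_right y) ((Submodule.span_singleton_le_iff_mem v _).2 hvx)) le_sup_left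
    (Submodule.finrank_sup_span_singleton hvy)
  exact ⟨z, hzy⟩

theorem isGradingFrom_meetCodim (H : IsPolarity h D) (x : IsotropicSubspace h D) :
    IsGradingFrom (dualPolarGraph h D) x x.meetCodim where
  base_eq := x.meetCodim_self
  le_add_one y z hyz := by
    have := finrank_meet_le_of_adj (x := x) hyz
    have := Submodule.finrank_mono (inf_le_right : x.meet y ⊓ x.meet z ≤ x.meet z)
    unfold meetCodim
    omega
  exists_adj y hyx := by
    obtain ⟨z, hzy⟩ := exists_isLower_of_ne H hyx
    exact ⟨z, isLower_iff_meetCodim.1 hzy⟩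

variable [Finite K]

theorem exists_isLower_of_finrank_pos (H : IsRegularPolarity h D s t) (ht : 0 < t)
    {x z : IsotropicSubspace h D} (hz : 0 < finrank K (x.meet z)) : ∃ y, x.IsLower z y := by
  classical
  have hs : 0 < s := H.card_eq ▸ Nat.card_pos
  have hpos : 0 < (Finset.univ.filter fun y => x.IsLower z y).card := by
    rw [card_upper H x z]
    have := Finset.sum_pos (fun k _ => pow_pos hs k) (Finset.nonempty_range_iff.2 hz.ne')
    positivity
  obtain ⟨y, hy⟩ := Finset.card_pos.1 hpos
  exact ⟨y, (Finset.mem_filter.1 hy).2⟩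

theorem exists_meetCodim_eq (H : IsRegularPolarity h D s t) (ht : 0 < t)
    (x : IsotropicSubspace h D) {k : ℕ} (hk : k ≤ D) : ∃ y, x.meetCodim y = k := by
  induction k with
  | zero => exact ⟨x, x.meetCodim_self⟩
  | succ k ih =>
    obtain ⟨z, hz⟩ := ih (by omega)
    have := x.finrank_meet_add_meetCodim z
    obtain ⟨y, hy⟩ := exists_isLower_of_finrank_pos H ht (by omega : 0 < finrank K (x.meet z))
    exact ⟨y, hz ▸ (isLower_iff_meetCodim.1 hy).2⟩

theorem dualPolarGraph_eccent (H : IsRegularPolarity h D s t) (ht : 0 < t)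
    (x : IsotropicSubspace h D) : (dualPolarGraph h D).eccent x = D :=
  (isGradingFrom_meetCodim H.toIsPolarity x).eccent_eq (fun _ => Nat.sub_le _ _)
    (exists_meetCodim_eq H ht x le_rfl)

theorem flatDeleted_eccent (H : IsRegularPolarity h D s t) (ht : 0 < t)
    (x : IsotropicSubspace h D) : ((dualPolarGraph h D).flatDeleted x).eccent x = D :=
  (isGradingFrom_meetCodim H.toIsPolarity x).flatDeleted.eccent_eq (fun _ => Nat.sub_le _ _)
    (exists_meetCodim_eq H ht x le_rfl)

/-- The vertices through a common `(D - 1)`-dimensional subspace form a clique. -/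
theorem dualPolarGraph_not_isBipartite (H : IsRegularPolarity h D s t) (ht : 1 < t) (hD : 0 < D)
    (x : IsotropicSubspace h D) : ¬ (dualPolarGraph h D).IsBipartite := by
  obtain ⟨y₀, hxy₀, -⟩ := exists_isLower_of_finrank_pos H (x := x) (z := x) (zero_lt_one.trans ht)
    (by rwa [meet, inf_idem, x.finrank_eq])
  set C := x.carrier ⊓ y₀.carrier
  have hC : finrank K C + 1 = D := hxy₀
  obtain ⟨y, hy, z, hz, hyz⟩ := Set.one_lt_ncard_iff_nontrivial.1
    (ht.trans_eq (H.ncard_inf_eq x C inf_le_left hC).symm)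
  have hxy : (dualPolarGraph h D).Adj x y := by rwa [adj_iff_finrank_inf, hy]
  have hxz : (dualPolarGraph h D).Adj x z := by rwa [adj_iff_finrank_inf, hz]
  have hyz' := adj_of_le hyz hC (hy.ge.trans inf_le_right) (hz.ge.trans inf_le_right)
  rintro ⟨c⟩
  have := c.valid hxy
  have := c.valid hxz
  have := c.valid hyz'
  omega

theorem loweringMatrix_dualPolarGraph (H : IsPolarity h D) (x : IsotropicSubspace h D) :
    (dualPolarGraph h D).loweringMatrix x = lowerMatrix ℂ x := by
  rw [(isGradingFrom_meetCodim H x).loweringMatrix_eq, lowerMatrix]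
  ext z y
  simp only [Matrix.of_apply]
  congr 1
  exact propext isLower_iff_meetCodim.symm

theorem uniformEquationOn (H : IsRegularPolarity h D s t) (x : IsotropicSubspace h D) (i : ℕ) :
    (dualPolarGraph h D).UniformEquationOn x i (-((s : ℂ) ^ 2 / (s + 1)))
      (-((s : ℂ)⁻¹ / (s + 1))) (t * (s : ℂ) ^ (D - 1)) := by
  have hs : (s : ℂ) ≠ 0 := Nat.cast_ne_zero.2 (H.card_eq ▸ Nat.card_pos.ne')
  have hs1 : (s : ℂ) + 1 ≠ 0 := Nat.cast_add_one_ne_zero s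
  intro v _
  rw [(isGradingFrom_meetCodim H.toIsPolarity x).raisingMatrix_eq,
    loweringMatrix_dualPolarGraph H.toIsPolarity]
  congr 1
  have hrel := congrArg (((s : ℂ) + 1)⁻¹ • ·) (lowerMatrix_relation ℂ x H hs)
  simp only [smul_add, smul_sub, smul_smul, inv_mul_cancel₀ hs1, inv_mul_cancel_left₀ hs1,
    one_smul] at hrel
  rw [← hrel, sub_eq_add_neg, ← neg_smul]
  congr 3 <;> ring

end Distance

section Hermitian

variable {K V : Type*} [Field K] [Fintype K] [AddCommGroup V] [Module K V] [FiniteDimensional K V]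
  {σ : K →+* K} {h : V →ₛₗ[σ] V →ₗ[K] K} {D r : ℕ} {q : ℤ}

theorem uniformEquationOn_of_isHermitianForm (H : IsHermitianForm h D r) (hD : 0 < D)
    (hqr : q = -(r : ℤ)) (x : IsotropicSubspace h D) (i : ℕ) :
    (dualPolarGraph h D).UniformEquationOn x i (-((q : ℂ) ^ 4 / ((q : ℂ) ^ 2 + 1)))
      (-((q : ℂ) ^ (-2 : ℤ) / ((q : ℂ) ^ 2 + 1))) ((-(q : ℂ)) ^ (2 * D - 1)) := by
  have hq : (q : ℂ) = -(r : ℂ) := by rw [hqr, Int.cast_neg, Int.cast_natCast]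
  have hminus : (q : ℂ) ^ 4 / ((q : ℂ) ^ 2 + 1) = ((r ^ 2 : ℕ) : ℂ) ^ 2 / ((r ^ 2 : ℕ) + 1) := by
    rw [hq, Nat.cast_pow, neg_sq, ← pow_mul, Even.neg_pow (by decide)]
  have hplus : (q : ℂ) ^ (-2 : ℤ) / ((q : ℂ) ^ 2 + 1) =
      ((r ^ 2 : ℕ) : ℂ)⁻¹ / ((r ^ 2 : ℕ) + 1) := by
    rw [hq, Nat.cast_pow, _root_.zpow_neg, zpow_ofNat, neg_sq]
  have hscalar : (-(q : ℂ)) ^ (2 * D - 1) = r * ((r ^ 2 : ℕ) : ℂ) ^ (D - 1) := by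
    rw [hq, neg_neg, Nat.cast_pow, ← pow_mul, ← pow_succ']
    congr 1
    omega
  rw [hminus, hplus, hscalar]
  exact uniformEquationOn H.isRegularPolarity x i

theorem isStronglyUniformStructure_flatDeleted (H : IsHermitianForm h D r) (hD : 0 < D)
    (hqr : q = -(r : ℤ)) (x : IsotropicSubspace h D) :
    ((dualPolarGraph h D).flatDeleted x).IsStronglyUniformStructure x
      (dualPolarParameterMatrix q D) (fun _ => (-(q : ℂ)) ^ (2 * D - 1)) where
  connected := (isGradingFrom_meetCodim H.isPolarity x).flatDeleted.connected
  bipartite := (isGradingFrom_meetCodim H.isPolarity x).isBipartite_flatDeleted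
  eccent_eq := flatDeleted_eccent H.isRegularPolarity (zero_lt_one.trans H.one_lt) x
  isParameterMatrix := isParameterMatrix_dualPolarParameterMatrix (H.one_lt_abs hqr) D
  equation i := by
    have Hx := isGradingFrom_meetCodim H.isPolarity x
    rw [Hx.uniformEquationOn_flatDeleted]
    exact Hx.uniformEquationOn_congr (uniformEquationOn_of_isHermitianForm H hD hqr x _)
      (fun hi => eMinus_dualPolarParameterMatrix q hi (by omega)) fun y hy =>
      ePlus_dualPolarParameterMatrix q (by omega) (hy.trans_le (Nat.sub_le _ _))
  eMinus_ne_zero _ :=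
    eMinus_dualPolarParameterMatrix_ne_zero (abs_pos.1 (zero_lt_one.trans (H.one_lt_abs hqr)))
  ePlus_ne_zero _ :=
    ePlus_dualPolarParameterMatrix_ne_zero (abs_pos.1 (zero_lt_one.trans (H.one_lt_abs hqr)))

end Hermitian

end IsotropicSubspace

theorem theorem8p4_general
    {K V : Type*} [Field K] [Fintype K] [AddCommGroup V] [Module K V] [FiniteDimensional K V]
    (D : ℕ) (hD : 0 < D)
    (q : ℤ) (r : ℕ) (hqr : q = -(r : ℤ)) (hK : Fintype.card K = r ^ 2)
    (hV : Module.finrank K V = 2 * D)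
    (σ : K →+* K) (hσ : ∀ a : K, σ a = a ^ r)
    (h : V →ₛₗ[σ] V →ₗ[K] K) (hherm : ∀ u v : V, h v u = σ (h u v)) (hnd : h.Nondegenerate)
    (x : IsotropicSubspace h D) :
    (∀ i : ℕ, 1 ≤ i → i ≤ D → (dualPolarGraph h D).UniformEquationOn x i
      (-((q : ℂ) ^ 4 / ((q : ℂ) ^ 2 + 1))) (-((q : ℂ) ^ (-2 : ℤ) / ((q : ℂ) ^ 2 + 1)))
      ((-(q : ℂ)) ^ (2 * D - 1))) ∧
    (dualPolarGraph h D).eccent x = D ∧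
    SimpleGraph.IsParameterMatrix (dualPolarParameterMatrix q D) ∧
    (dualPolarGraph h D).SupportsStronglyUniformWith x
      (dualPolarParameterMatrix q D) (fun _ => (-(q : ℂ)) ^ (2 * D - 1)) := by
  have H : IsHermitianForm h D r := ⟨hK, hσ, hherm, hnd, hV⟩
  have ht : 0 < r := zero_lt_one.trans H.one_lt
  exact ⟨fun i _ _ => IsotropicSubspace.uniformEquationOn_of_isHermitianForm H hD hqr x i,
    IsotropicSubspace.dualPolarGraph_eccent H.isRegularPolarity ht x,
    isParameterMatrix_dualPolarParameterMatrix (H.one_lt_abs hqr) D,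
    (IsotropicSubspace.isGradingFrom_meetCodim H.isPolarity x).connected,
    IsotropicSubspace.dualPolarGraph_not_isBipartite H.isRegularPolarity H.one_lt hD x,
    IsotropicSubspace.isStronglyUniformStructure_flatDeleted H hD hqr x⟩

theorem theorem8p4
    {K V : Type*} [Field K] [Fintype K] [AddCommGroup V] [Module K V] [FiniteDimensional K V]
    (D : ℕ) (hD : 3 ≤ D)
    -- `r = -q`, the field `K` has `r ^ 2` elements (so `r` is a prime power, and `q ≤ -2`)
    (q : ℤ) (r : ℕ) (hqr : q = -(r : ℤ)) (hK : Fintype.card K = r ^ 2)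
    (hV : Module.finrank K V = 2 * D)
    -- `h` is a nondegenerate Hermitian form with respect to the involution `a ↦ a ^ r`
    (σ : K →+* K) (hσ : ∀ a : K, σ a = a ^ r)
    (h : V →ₛₗ[σ] V →ₗ[K] K) (hherm : ∀ u v : V, h v u = σ (h u v)) (hnd : h.Nondegenerate)
    (x : IsotropicSubspace h D) :
    -- the identity on `E*_i V` for `1 ≤ i ≤ D`
    (∀ i : ℕ, 1 ≤ i → i ≤ D → (dualPolarGraph h D).UniformEquationOn x i
      (-((q : ℂ) ^ 4 / ((q : ℂ) ^ 2 + 1))) (-((q : ℂ) ^ (-2 : ℤ) / ((q : ℂ) ^ 2 + 1)))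
      ((-(q : ℂ)) ^ (2 * D - 1))) ∧
    -- the eccentricity of `x` is `D`, the matrix is a parameter matrix, and together with the
    -- constant vector it is a strongly uniform structure supported by the graph
    (dualPolarGraph h D).eccent x = D ∧
    SimpleGraph.IsParameterMatrix (dualPolarParameterMatrix q D) ∧
    (dualPolarGraph h D).SupportsStronglyUniformWith x
      (dualPolarParameterMatrix q D) (fun _ => (-(q : ℂ)) ^ (2 * D - 1)) := by
  exact theorem8p4_general D (by omega) q r hqr hK hV σ hσ h hherm hnd x
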